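/- Let $p\in\mathbb N$, let $D^p=D([0,1],\mathbb R^p)$ be the space of càdlàg functions $[0,1]\to\mathbb R^p$, and let $\|w\|=\sup_{t\in[0,1]}|w(t)|$, where $|\cdot|$ is the Euclidean norm. The Skorokhod topology on $D^p$ is the one of the metric $\sigma(w,v)=\inf_{\lambda}\max\{\|\lambda-I\|,\|w-v\circ\lambda\|\}$, where $\lambda$ runs over the strictly increasing continuous bijections of $[0,1]$ and $I$ is the identity. Random elements of $D^p$ are measurable with respect to the Borel $\sigma$-algebra of the Skorokhod topology. Let $M^0$ be the class of continuous functions $g:(D^p,\|\cdot\|)\to\mathbb R$ that are twice Fréchet differentiable and satisfy $$\|g\|_{M^0}:=\sup_{w}|g(w)|+\sup_{w}\|Dg(w)\|+\sup_{w}\|D^2g(w)\|+\sup_{w,\,h\neq 0}\frac{\|D^2g(w+h)-D^2g(w)\|}{\|h\|}<\infty ,$$ where $w,h$ run over $D^p$ and $\|B\|=\sup_{\|u\|=1}|B[u,\dots,u]|$ for a $k$-linear form $B$. Suppose that, for each $n$, $\mathbf Y_n$ is a random element of $D^p$ and $r_n>0$ is a number such that, almost surely, there is a partition $0=a_0<a_1<\dots<a_m=1$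 (which may be random) with $a_{k+1}-a_k\ge r_n$ and $\mathbf Y_n$ constant on $[a_k,a_{k+1})$ for all $0\le k<m$. Let $(\mathbf Z_n)$ be random elements of $D^p$ that converge in distribution, with respect to the Skorokhod topology, to a random element $\mathbf Z$ of $D^p$ that is almost surely continuous. (All these random elements may live on different probability spaces.) Suppose that there are a constant $C$ and a sequence $(\tau_n)$ of real numbers such that $$\tau_n\to 0,\qquad \tau_n\log^2(1/r_n)\to 0,$$ and $$|\mathbb E g(\mathbf Y_n)-\mathbb E g(\mathbf Z_n)|\le C\,\tau_n\,\|g\|_{M^0}$$ for every $n$ and every $g\in M^0$ that is Borel measurable for the Skorokhod topology. Then $\mathbf Y_n$ converges weakly to $\mathbf Z$ in $D^p$ in both the uniform and the Skorokhod topology. Here weak convergence in the uniform topology is understood in the sense of Hoffmann-Jørgensen, because $\mathbf Y_n$ need not be measurable for the Borel $\sigma$-algebra of $\|\cdot\|$: $\mathbf Z$ is almost everywhere equal to a map that is measurable for that $\sigma$-algebra, and $\mathbb E^*f(\mathbf Y_n)\to\mathbb E f(\mathbf Z)$ for every bounded $\|\cdot\|$-continuous $f:D^p\to\mathbb R$,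 where $\mathbb E^*\varphi=\inf\{\mathbb E\psi:\psi\ge\varphi,\ \psi\text{ integrable}\}$ is the outer expectation, which is the expectation when $f(\mathbf Y_n)$ is measurable. -/

import Mathlib

open MeasureTheory Filter Topology Set
open scoped ENNReal unitInterval BoundedContinuousFunction

noncomputable section

/-- The space of functions `w : [0,1] → ℝ^p` that are right-continuous with left limits,
as a linear subspace of all functions. -/
def cadlagSubmodule (p : ℕ) : Submodule ℝ (I → EuclideanSpace ℝ (Fin p)) where
  carrier := {w | (∀ t, ContinuousWithinAt w (Ici t) t) ∧ ∀ t, ∃ l, Tendsto w (𝓝[<] t) (𝓝 l)}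
  zero_mem' := ⟨fun _ => continuousWithinAt_const, fun _ => ⟨0, tendsto_const_nhds⟩⟩
  add_mem' := by
    rintro v w ⟨hv, hv'⟩ ⟨hw, hw'⟩
    refine ⟨fun t => (hv t).add (hw t), fun t => ?_⟩
    obtain ⟨a, ha⟩ := hv' t
    obtain ⟨b, hb⟩ := hw' t
    exact ⟨a + b, ha.add hb⟩
  smul_mem' := by
    rintro c w ⟨hw, hw'⟩
    refine ⟨fun t => (hw t).const_smul c, fun t => ?_⟩
    obtain ⟨a, ha⟩ := hw' t
    exact ⟨c • a, ha.const_smul c⟩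

/-- `D^p`, the space of càdlàg functions `[0,1] → ℝ^p`. On this type the topology is that of the
supremum norm. -/
def CadlagPath (p : ℕ) : Type := ↥(cadlagSubmodule p)

namespace CadlagPath

variable {p : ℕ}

instance : AddCommGroup (CadlagPath p) := inferInstanceAs (AddCommGroup ↥(cadlagSubmodule p))

instance : Module ℝ (CadlagPath p) := inferInstanceAs (Module ℝ ↥(cadlagSubmodule p))

instance : FunLike (CadlagPath p) I (EuclideanSpace ℝ (Fin p)) where
  coe w := w.1
  coe_injective _ _ h := Subtype.ext h

@[simp] theorem zero_apply (t : I) : (0 : CadlagPath p) t = 0 := rfl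

@[simp] theorem add_apply (v w : CadlagPath p) (t : I) : (v + w) t = v t + w t := rfl

@[simp] theorem neg_apply (w : CadlagPath p) (t : I) : (-w) t = -w t := rfl

@[simp] theorem sub_apply (v w : CadlagPath p) (t : I) : (v - w) t = v t - w t := rfl

@[simp] theorem smul_apply (c : ℝ) (w : CadlagPath p) (t : I) : (c • w) t = c • w t := rfl

theorem right_continuous (w : CadlagPath p) (t : I) : ContinuousWithinAt w (Ici t) t := w.2.1 t

theorem exists_left_limit (w : CadlagPath p) (t : I) : ∃ l, Tendsto w (𝓝[<] t) (𝓝 l) := w.2.2 t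

/-- A càdlàg function on `[0,1]` is bounded. -/
theorem exists_bound (w : CadlagPath p) : ∃ B, ∀ t, ‖w t‖ ≤ B := by
  have key : ∃ B, ∀ t ∈ (univ : Set I), ‖w t‖ ≤ B := by
    refine isCompact_univ.induction_on (p := fun s => ∃ B, ∀ t ∈ s, ‖w t‖ ≤ B) ⟨0, by simp⟩ ?_ ?_ ?_
    · rintro s t hst ⟨B, hB⟩
      exact ⟨B, fun x hx => hB x (hst hx)⟩
    · rintro s t ⟨B, hB⟩ ⟨B', hB'⟩
      refine ⟨max B B', fun x hx => ?_⟩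
      rcases hx with hx | hx
      · exact (hB x hx).trans (le_max_left _ _)
      · exact (hB' x hx).trans (le_max_right _ _)
    · intro t _
      obtain ⟨l, hl⟩ := w.exists_left_limit t
      have h1 : ∀ᶠ x in 𝓝[<] t, ‖w x‖ < ‖l‖ + 1 := hl.norm.eventually (gt_mem_nhds (by linarith))
      have h2 : ∀ᶠ x in 𝓝[≥] t, ‖w x‖ < ‖w t‖ + 1 :=
        (w.right_continuous t).norm.eventually (gt_mem_nhds (by linarith))
      refine ⟨{x | ‖w x‖ ≤ max (‖l‖ + 1) (‖w t‖ + 1)}, ?_, max (‖l‖ + 1) (‖w t‖ + 1), fun x hx => hx⟩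
      rw [nhdsWithin_univ, ← nhdsLT_sup_nhdsGE]
      refine mem_sup.2 ⟨?_, ?_⟩
      · filter_upwards [h1] with x hx
        exact hx.le.trans (le_max_left _ _)
      · filter_upwards [h2] with x hx
        exact hx.le.trans (le_max_right _ _)
  obtain ⟨B, hB⟩ := key
  exact ⟨B, fun t => hB t (mem_univ t)⟩

theorem bddAbove_norm (w : CadlagPath p) : BddAbove (range fun t => ‖w t‖) := by
  obtain ⟨B, hB⟩ := w.exists_bound
  exact ⟨B, by rintro _ ⟨t, rfl⟩; exact hB t⟩

/-- The supremum norm `‖w‖ = sup_t |w(t)|`, with `|·|` the Euclidean norm. -/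
instance : Norm (CadlagPath p) := ⟨fun w => ⨆ t, ‖w t‖⟩

theorem norm_def (w : CadlagPath p) : ‖w‖ = ⨆ t, ‖w t‖ := rfl

theorem norm_apply_le (w : CadlagPath p) (t : I) : ‖w t‖ ≤ ‖w‖ := le_ciSup w.bddAbove_norm t

theorem norm_le {w : CadlagPath p} {B : ℝ} (h : ∀ t, ‖w t‖ ≤ B) : ‖w‖ ≤ B := ciSup_le h

instance : NormedAddCommGroup (CadlagPath p) :=
  AddGroupNorm.toNormedAddCommGroup
    { toFun := fun w => ‖w‖
      map_zero' := by simp [norm_def]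
      add_le' := fun v w => norm_le fun t =>
        (norm_add_le (v t) (w t)).trans (add_le_add (v.norm_apply_le t) (w.norm_apply_le t))
      neg' := fun w => by simp [norm_def]
      eq_zero_of_map_eq_zero' := fun w hw => DFunLike.ext _ _ fun t =>
        norm_le_zero_iff.1 ((w.norm_apply_le t).trans hw.le) }

instance : NormedSpace ℝ (CadlagPath p) where
  norm_smul_le c w := norm_le fun t => by
    rw [smul_apply, norm_smul]
    exact mul_le_mul_of_nonneg_left (w.norm_apply_le t) (norm_nonneg c)

/-- The Borel σ-algebra of the supremum norm. -/
instance : MeasurableSpace (CadlagPath p) := borel _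

instance : BorelSpace (CadlagPath p) := ⟨rfl⟩

end CadlagPath

/-- `D^p` again, as a type that carries the Skorokhod topology. -/
def SkorokhodSpace (p : ℕ) : Type := CadlagPath p

namespace SkorokhodSpace

variable {p : ℕ}

/-- The identity map from `D^p` with the Skorokhod topology to `D^p` with the supremum norm. -/
def toCadlag (w : SkorokhodSpace p) : CadlagPath p := w

/-- `max {‖lam - I‖, ‖w - v ∘ lam‖}` for a time change `lam`. The strictly increasing (continuous)
bijections of `[0,1]` are exactly its order automorphisms. -/
def timeChangeCost (w v : SkorokhodSpace p) (lam : I ≃o I) : ℝ :=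
  max (⨆ t : I, |(lam t : ℝ) - t|) (⨆ t : I, ‖w.toCadlag t - v.toCadlag (lam t)‖)

/-- The Skorokhod metric. -/
def skorokhodDist (w v : SkorokhodSpace p) : ℝ := ⨅ lam : I ≃o I, timeChangeCost w v lam

theorem abs_le_cost (w v : SkorokhodSpace p) (lam : I ≃o I) (t : I) :
    |(lam t : ℝ) - t| ≤ timeChangeCost w v lam := by
  refine le_trans (le_ciSup (f := fun t : I => |(lam t : ℝ) - t|) ⟨1, ?_⟩ t) (le_max_left _ _)
  rintro _ ⟨s, rfl⟩
  have h1 := (lam s).2.1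
  have h2 := (lam s).2.2
  have h3 := s.2.1
  have h4 := s.2.2
  exact abs_le.2 ⟨by linarith, by linarith⟩

theorem norm_le_cost (w v : SkorokhodSpace p) (lam : I ≃o I) (t : I) :
    ‖w.toCadlag t - v.toCadlag (lam t)‖ ≤ timeChangeCost w v lam := by
  refine le_trans (le_ciSup (f := fun t : I => ‖w.toCadlag t - v.toCadlag (lam t)‖)
    ⟨‖w.toCadlag‖ + ‖v.toCadlag‖, ?_⟩ t) (le_max_right _ _)
  rintro _ ⟨s, rfl⟩
  exact (norm_sub_le _ _).trans
    (add_le_add (CadlagPath.norm_apply_le _ _) (CadlagPath.norm_apply_le _ _))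

theorem cost_le {w v : SkorokhodSpace p} {lam : I ≃o I} {B : ℝ}
    (h1 : ∀ t : I, |(lam t : ℝ) - t| ≤ B)
    (h2 : ∀ t : I, ‖w.toCadlag t - v.toCadlag (lam t)‖ ≤ B) : timeChangeCost w v lam ≤ B :=
  max_le (ciSup_le h1) (ciSup_le h2)

theorem cost_nonneg (w v : SkorokhodSpace p) (lam : I ≃o I) : 0 ≤ timeChangeCost w v lam :=
  (abs_nonneg _).trans (abs_le_cost w v lam 0)

theorem bddBelow_cost (w v : SkorokhodSpace p) : BddBelow (range (timeChangeCost w v)) :=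
  ⟨0, by rintro _ ⟨lam, rfl⟩; exact cost_nonneg w v lam⟩

theorem skorokhodDist_comm_le (w v : SkorokhodSpace p) : skorokhodDist w v ≤ skorokhodDist v w := by
  refine le_ciInf fun lam => (ciInf_le (bddBelow_cost w v) lam.symm).trans (cost_le ?_ ?_)
  · intro t
    have h := abs_le_cost v w lam (lam.symm t)
    rwa [lam.apply_symm_apply, abs_sub_comm] at h
  · intro t
    have h := norm_le_cost v w lam (lam.symm t)
    rwa [lam.apply_symm_apply, norm_sub_rev] at h

/-- The Skorokhod topology on `D^p` is the one of the Skorokhod metric. -/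
instance : PseudoMetricSpace (SkorokhodSpace p) where
  dist := skorokhodDist
  dist_self w := by
    refine le_antisymm ((ciInf_le (bddBelow_cost w w) (OrderIso.refl I)).trans
      (cost_le (fun t => by simp) fun t => by simp)) (le_ciInf fun lam => cost_nonneg w w lam)
  dist_comm w v := le_antisymm (skorokhodDist_comm_le w v) (skorokhodDist_comm_le v w)
  dist_triangle u v w := by
    refine le_ciInf_add_ciInf fun lam mu =>
      (ciInf_le (bddBelow_cost u w) (lam.trans mu)).trans (cost_le ?_ ?_)
    · intro t
      have h1 := abs_le_cost u v lam t
      have h2 := abs_le_cost v w mu (lam t)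
      have h3 := abs_sub_le (mu (lam t) : ℝ) (lam t) t
      simp only [OrderIso.trans_apply]
      linarith
    · intro t
      have h1 := norm_le_cost u v lam t
      have h2 := norm_le_cost v w mu (lam t)
      have h3 := norm_sub_le_norm_sub_add_norm_sub (u.toCadlag t) (v.toCadlag (lam t))
        (w.toCadlag (mu (lam t)))
      simp only [OrderIso.trans_apply]
      linarith

/-- The Borel σ-algebra of the Skorokhod topology. -/
instance : MeasurableSpace (SkorokhodSpace p) := borel _

instance : BorelSpace (SkorokhodSpace p) := ⟨rfl⟩

end SkorokhodSpace

/-- `[0,1]` can be divided into finitely many intervals of constancy `[a_k, a_{k+1})` of `w`,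
`0 = a_0 < a_1 < ⋯ < a_m = 1`, each of length at least `r`. The value at the end point `1`, which
none of these half-open intervals contains, is free. -/
def IsPiecewiseConstant {p : ℕ} (w : CadlagPath p) (r : ℝ) : Prop :=
  ∃ (m : ℕ) (a : ℕ → ℝ), a 0 = 0 ∧ a m = 1 ∧ ∀ k < m, a k < a (k + 1) ∧ r ≤ a (k + 1) - a k ∧
    ∀ s t : I, (s : ℝ) ∈ Ico (a k) (a (k + 1)) → (t : ℝ) ∈ Ico (a k) (a (k + 1)) → w s = w t

/-- `sup_{‖h‖ = 1} |q(h)|`. With `q(h) = B[h, …, h]` this is the norm of the `k`-linear form `B`. -/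
def sphereSup {p : ℕ} (q : CadlagPath p → ℝ) : ℝ≥0∞ :=
  ⨆ (h : CadlagPath p) (_ : ‖h‖ = 1), ‖q h‖ₑ

/-- `‖Dg(w)‖` -/
def derivNorm {p : ℕ} (g : CadlagPath p → ℝ) (w : CadlagPath p) : ℝ≥0∞ :=
  sphereSup fun u => fderiv ℝ g w u

/-- `‖D²g(w)‖` -/
def secondDerivNorm {p : ℕ} (g : CadlagPath p → ℝ) (w : CadlagPath p) : ℝ≥0∞ :=
  sphereSup fun u => fderiv ℝ (fderiv ℝ g) w u u

/-- `‖D²g(w + h) - D²g(w)‖` -/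
def secondDerivDiffNorm {p : ℕ} (g : CadlagPath p → ℝ) (w h : CadlagPath p) : ℝ≥0∞ :=
  sphereSup fun u => (fderiv ℝ (fderiv ℝ g) (w + h) - fderiv ℝ (fderiv ℝ g) w) u u

/-- The class `M`: continuous functionals with `sup_w |g(w)| / (1 + ‖w‖³) < ∞` that are twice
Fréchet differentiable (for the supremum norm) with a Lipschitz second derivative. -/
structure MemM {p : ℕ} (g : CadlagPath p → ℝ) : Prop where
  continuous : Continuous g
  growth : ∃ K : ℝ, ∀ w, |g w| / (1 + ‖w‖ ^ 3) ≤ K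
  differentiable : Differentiable ℝ g
  differentiable_fderiv : Differentiable ℝ (fderiv ℝ g)
  lipschitz : ∃ k : ℝ, ∀ w h, secondDerivDiffNorm g w h ≤ ENNReal.ofReal (k * ‖h‖)

/-- `‖g‖_{M⁰}`, with values in `[0, ∞]`. -/
def normM0 {p : ℕ} (g : CadlagPath p → ℝ) : ℝ≥0∞ :=
  (⨆ w, ‖g w‖ₑ) + (⨆ w, derivNorm g w) + (⨆ w, secondDerivNorm g w) +
    ⨆ (w : CadlagPath p) (h : CadlagPath p) (_ : h ≠ 0), secondDerivDiffNorm g w h / ‖h‖ₑ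

/-- The class `M⁰`. -/
structure MemM0 {p : ℕ} (g : CadlagPath p → ℝ) : Prop where
  memM : MemM g
  normM0_lt_top : normM0 g < ∞

/-- The outer expectation `E^* φ = inf {E ψ : ψ ≥ φ, ψ integrable}` of a bounded, not necessarily
measurable, function `φ`. -/
def outerExpectation {Ω : Type*} [MeasurableSpace Ω] (P : Measure Ω) (φ : Ω → ℝ) : ℝ :=
  sInf {x | ∃ ψ : Ω → ℝ, Integrable ψ P ∧ (∀ ω, φ ω ≤ ψ ω) ∧ x = ∫ ω, ψ ω ∂P}

/-- On integrable functions, the outer expectation is the expectation. -/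
theorem outerExpectation_eq_integral {Ω : Type*} [MeasurableSpace Ω] {P : Measure Ω} {φ : Ω → ℝ}
    (hφ : Integrable φ P) : outerExpectation P φ = ∫ ω, φ ω ∂P := by
  refine IsLeast.csInf_eq ⟨⟨φ, hφ, fun _ => le_rfl, rfl⟩, ?_⟩
  rintro _ ⟨ψ, hψ, hle, rfl⟩
  exact integral_mono hφ hψ hle

/-- Weak convergence `Y_n ⇒ Z` in a space `X` in the sense of Hoffmann-Jørgensen, in which the
`Y_n` need not be measurable for the Borel σ-algebra of `X`: the limit `Z` is a Borel random element
and `E^* f(Y_n) → E f(Z)` for every bounded continuous `f : X → ℝ`. If the `f(Y_n)` are measurable,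
then `E^* f(Y_n) = E f(Y_n)`. -/
structure WeaklyTendsto {X : Type*} [TopologicalSpace X] [MeasurableSpace X] [BorelSpace X]
    {Ω : ℕ → Type*} [∀ n, MeasurableSpace (Ω n)] {Ω' : Type*} [MeasurableSpace Ω']
    (Y : ∀ n, Ω n → X) (Z : Ω' → X) (P : ∀ n, Measure (Ω n)) (Q : Measure Ω') : Prop where
  aemeasurable_limit : AEMeasurable Z Q
  tendsto : ∀ f : X →ᵇ ℝ,
    Tendsto (fun n => outerExpectation (P n) fun ω => f (Y n ω)) atTop (𝓝 (∫ ω, f (Z ω) ∂Q))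

end

/-!
The gap between the `M⁰` functionals and all continuous ones is closed by smooth bump functions on
balls of `D^p`, whose `M⁰` norms must be compared with `log² (1 / r)`.

The supremum norm is not differentiable, but a path that is constant on intervals of length `r`
takes all its values on a grid of about `1 / r` points of `[0,1]`. On such paths `‖w - x‖`, for
a continuous `x`, is comparable to a maximum of finitely many affine functionals, and the maximum is
approximated by `logSumExp β`, that is `β⁻¹ log ∑ exp (β ·)`. The error is `β⁻¹` times the
logarithm of the number of functionals, so `β` of order `log (1 / r)` suffices. The `i`-th
derivative of this smooth maximum is of order `β ^ (i - 1)` whatever the number of functionals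
(`norm_iteratedFDeriv_logSumExp_le`), so a fixed smooth function of it has a norm of order `β ^ 2`
in `M⁰`, that is `log² (1 / r)`.

Let `f` be bounded and Lipschitz for the Skorokhod metric. The law of the limit is carried by the
continuous functions, which are separable, so all but a small part of it lies in finitely many
small balls with continuous centres. Those balls are open for the Skorokhod topology
(`SkorokhodSpace.isOpen_norm_sub_lt`), so the same holds for `Z_n` with large `n`. A blend `G` of
the values of `f` at the centres, with bump functions as weights, approximates `f` where the bumps
cover, and the defect of covering is `Q = ∏ (1 - φ_l)` (`exists_approx_blend`). Both are of class
`M⁰`. That `E Q(Z_n)` is small carries over to `Y_n`, and then `E f(Y_n)` is close to `E G(Y_n)`,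
hence to `E G(Z_n)` and to `E f(Z_n)` (`tendsto_integral_sub_of_lipschitz`). This gives convergence
for the Skorokhod topology.

For the uniform topology no more about `Y_n` is needed: a function that is continuous for the
supremum norm is continuous for the Skorokhod topology at every continuous path, so the outer
expectation is squeezed between expectations of Skorokhod-Lipschitz envelopes
(`weaklyTendsto_toCadlag`).
-/

noncomputable section

/-! ### Functions with bounded derivatives up to order three -/

section DerivBounds

variable {E : Type*} [NormedAddCommGroup E] [NormedSpace ℝ E]

/-- `g` has class `C³` and its `i`-th derivative has norm at most `c * B ^ i` for `i ≤ 3`. The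
geometric form of the bounds makes the class stable under products and under composition with a
smooth function, with the same `B`. -/
structure HasDerivBounds (c B : ℝ) (g : E → ℝ) : Prop where
  contDiff : ContDiff ℝ 3 g
  norm_le : ∀ i ≤ 3, ∀ w, ‖iteratedFDeriv ℝ i g w‖ ≤ c * B ^ i

namespace HasDerivBounds

variable {c c' B : ℝ} {g g' : E → ℝ}

theorem nonneg (h : HasDerivBounds c B g) : 0 ≤ c := by
  simpa using (norm_nonneg _).trans (h.norm_le 0 (by norm_num) 0)

theorem const (a : ℝ) (hB : 0 ≤ B) : HasDerivBounds |a| B (fun _ : E => a) := by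
  refine ⟨contDiff_const, fun i _ w => ?_⟩
  rcases Nat.eq_zero_or_pos i with rfl | hi
  · simp
  · rw [iteratedFDeriv_const_of_ne hi.ne']
    simpa using by positivity

theorem add (h : HasDerivBounds c B g) (h' : HasDerivBounds c' B g') :
    HasDerivBounds (c + c') B (fun w => g w + g' w) := by
  refine ⟨h.contDiff.add h'.contDiff, fun i hi w => ?_⟩
  have hi' : (i : WithTop ℕ∞) ≤ 3 := by exact_mod_cast hi
  have := iteratedFDeriv_add_apply (𝕜 := ℝ) (i := i) (x := w) (f := g) (g := g')
    (h.contDiff.contDiffAt.of_le hi') (h'.contDiff.contDiffAt.of_le hi')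
  change ‖iteratedFDeriv ℝ i (g + g') w‖ ≤ _
  rw [this, add_mul]
  exact (norm_add_le _ _).trans (add_le_add (h.norm_le i hi w) (h'.norm_le i hi w))

theorem mul (hB : 0 ≤ B) (h : HasDerivBounds c B g) (h' : HasDerivBounds c' B g') :
    HasDerivBounds (8 * (c * c')) B (fun w => g w * g' w) := by
  refine ⟨h.contDiff.mul h'.contDiff, fun i hi w => ?_⟩
  have hc := h.nonneg
  have hc' := h'.nonneg
  refine (norm_iteratedFDeriv_mul_le h.contDiff h'.contDiff w (by exact_mod_cast hi)).trans ?_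
  calc _ ≤ ∑ j ∈ Finset.range (i + 1), (i.choose j : ℝ) * (c * c' * B ^ i) := by
        refine Finset.sum_le_sum fun j hj => ?_
        have hj : j ≤ i := Nat.lt_succ_iff.1 (Finset.mem_range.1 hj)
        rw [mul_assoc]
        refine mul_le_mul_of_nonneg_left ?_ (by positivity)
        calc _ ≤ (c * B ^ j) * (c' * B ^ (i - j)) :=
              mul_le_mul (h.norm_le j (hj.trans hi) w) (h'.norm_le _ (by omega) w) (norm_nonneg _)
                (by positivity)
          _ = c * c' * (B ^ j * B ^ (i - j)) := by ring
          _ = c * c' * B ^ i := by rw [← pow_add, Nat.add_sub_cancel' hj]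
    _ = 2 ^ i * (c * c' * B ^ i) := by
        rw [← Finset.sum_mul, ← Nat.cast_sum, Nat.sum_range_choose]
        push_cast; rfl
    _ ≤ 2 ^ 3 * (c * c' * B ^ i) := by
        gcongr
        norm_num
    _ = 8 * (c * c') * B ^ i := by ring

/-- The first three derivatives of `ψ` are at most `A`, and those of `g` at most `B`, `B ^ 2`,
`B ^ 3`; no bound on `g` itself is needed. -/
theorem comp {ψ : ℝ → ℝ} {A : ℝ} (hψ : ContDiff ℝ 3 ψ)
    (hA : ∀ i ≤ 3, ∀ x, ‖iteratedFDeriv ℝ i ψ x‖ ≤ A) (hB : 0 ≤ B) (hg : ContDiff ℝ 3 g)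
    (hD : ∀ i, 1 ≤ i → i ≤ 3 → ∀ w, ‖iteratedFDeriv ℝ i g w‖ ≤ B ^ i) :
    HasDerivBounds (6 * A) B (fun w => ψ (g w)) := by
  refine ⟨hψ.comp hg, fun i hi w => ?_⟩
  have hA0 : 0 ≤ A := (norm_nonneg _).trans (hA 0 (by norm_num) 0)
  refine (norm_iteratedFDeriv_comp_le hψ hg (by exact_mod_cast hi) w
    (fun j hj => hA j (hj.trans hi) (g w)) (fun j hj hj' => hD j hj (hj'.trans hi) w)).trans ?_
  have : (i.factorial : ℝ) ≤ 6 := by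
    exact_mod_cast Nat.factorial_le hi
  gcongr

end HasDerivBounds

theorem exists_bound_iteratedFDeriv {ψ : ℝ → ℝ} (hψ : ContDiff ℝ 3 ψ) (hc : HasCompactSupport ψ) :
    ∃ A, ∀ i ≤ 3, ∀ x, ‖iteratedFDeriv ℝ i ψ x‖ ≤ A := by
  have h : ∀ i : ℕ, ∃ A, i ≤ 3 → ∀ x, ‖iteratedFDeriv ℝ i ψ x‖ ≤ A := fun i => by
    by_cases hi : i ≤ 3
    · obtain ⟨A, hA⟩ := (hc.iteratedFDeriv (𝕜 := ℝ) i).exists_bound_of_continuous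
        (hψ.continuous_iteratedFDeriv (by exact_mod_cast hi))
      exact ⟨A, fun _ => hA⟩
    · exact ⟨0, fun h => absurd h hi⟩
  choose A hA using h
  refine ⟨∑ i ∈ Finset.range 4, |A i|, fun i hi x => (hA i hi x).trans ((le_abs_self _).trans ?_)⟩
  exact Finset.single_le_sum (f := fun i => |A i|) (fun _ _ => abs_nonneg _)
    (Finset.mem_range.2 (by omega))

end DerivBounds

/-! ### The smooth maximum -/

section SmoothMaximum

/-- The smooth maximum `β⁻¹ log ∑ₖ exp (β aₖ)` of a finite family of real numbers. It exceeds the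
maximum by at most `β⁻¹ log |ι|`. -/
def logSumExp {ι : Type*} [Fintype ι] (β : ℝ) (a : ι → ℝ) : ℝ :=
  β⁻¹ * Real.log (∑ k, Real.exp (β * a k))

variable {E : Type*} [NormedAddCommGroup E] [NormedSpace ℝ E] {ι : Type*} [Fintype ι] {β : ℝ}

theorem sum_exp_pos [Nonempty ι] (a : ι → ℝ) : 0 < ∑ k, Real.exp (a k) :=
  Finset.sum_pos (fun _ _ => Real.exp_pos _) Finset.univ_nonempty

theorem le_logSumExp [Nonempty ι] (hβ : 0 < β) (a : ι → ℝ) (k : ι) : a k ≤ logSumExp β a := by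
  rw [logSumExp, ← div_eq_inv_mul, le_div_iff₀ hβ, mul_comm,
    Real.le_log_iff_exp_le (sum_exp_pos fun k => β * a k)]
  exact Finset.single_le_sum (f := fun k => Real.exp (β * a k)) (fun _ _ => (Real.exp_pos _).le)
    (Finset.mem_univ k)

theorem logSumExp_le [Nonempty ι] (hβ : 0 < β) {a : ι → ℝ} {m : ℝ} (h : ∀ k, a k ≤ m) :
    logSumExp β a ≤ m + Real.log (Fintype.card ι) / β := by
  have hc : (0 : ℝ) < Fintype.card ι := by exact_mod_cast Fintype.card_pos
  rw [logSumExp, ← div_eq_inv_mul, div_le_iff₀ hβ, add_mul, div_mul_cancel₀ _ hβ.ne',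
    Real.log_le_iff_le_exp (sum_exp_pos fun k => β * a k), Real.exp_add, Real.exp_log hc]
  calc _ ≤ ∑ _k : ι, Real.exp (m * β) := Finset.sum_le_sum fun k _ => Real.exp_le_exp.2 (by
          rw [mul_comm]; exact mul_le_mul_of_nonneg_right (h k) hβ.le)
    _ = _ := by simp [mul_comm]

variable (ℓ : ι → E →L[ℝ] ℝ) (a : ι → ℝ)

theorem contDiff_logSumExp [Nonempty ι] :
    ContDiff ℝ 3 fun w => logSumExp β fun k => ℓ k w - a k := by
  unfold logSumExp
  refine contDiff_const.mul (ContDiff.log ?_ fun w => (sum_exp_pos _).ne')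
  fun_prop

theorem norm_iteratedFDeriv_exp_comp_le (L : E →L[ℝ] ℝ) (i : ℕ) :
    ‖iteratedFDeriv ℝ i (fun h => Real.exp (L h)) 0‖ ≤ ‖L‖ ^ i := by
  have h := L.iteratedFDeriv_comp_right (i := i) (Real.contDiff_exp (n := i)) 0 le_rfl
  rw [Function.comp_def] at h
  rw [h]
  refine (ContinuousMultilinearMap.norm_compContinuousLinearMap_le _ _).trans_eq ?_
  rw [norm_iteratedFDeriv_eq_norm_iteratedDeriv, iteratedDeriv_eq_iterate, Real.iter_deriv_exp]
  simp

/-- An absolute constant that controls the first three derivatives of `logSumExp`. -/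
def logSumExpConst : ℝ :=
  6 * ∑ i ∈ Finset.range 4, ‖iteratedFDerivWithin ℝ i Real.log (Ioi 0) 1‖ + 1

theorem one_le_logSumExpConst : 1 ≤ logSumExpConst := by
  have : 0 ≤ ∑ i ∈ Finset.range 4, ‖iteratedFDerivWithin ℝ i Real.log (Ioi 0) 1‖ :=
    Finset.sum_nonneg fun _ _ => norm_nonneg _
  unfold logSumExpConst
  linarith

/-- The derivatives at the origin of the logarithm of a convex combination of exponentials
of linear functionals. The combination equals `1` there, so only the derivatives of `log` at `1`
enter, and the bound depends on neither the number of terms nor the weights. -/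
theorem norm_iteratedFDeriv_log_weighted_sum_exp_le {q : ι → ℝ} (hβ : 0 ≤ β)
    (hq : ∀ k, 0 ≤ q k) (hq1 : ∑ k, q k = 1) (hℓ : ∀ k, ‖ℓ k‖ ≤ β) {i : ℕ} (hi : 1 ≤ i)
    (hi3 : i ≤ 3) :
    ‖iteratedFDeriv ℝ i (fun h => Real.log (∑ k, q k * Real.exp (ℓ k h))) 0‖
      ≤ (logSumExpConst * β) ^ i := by
  set S : E → ℝ := fun h => ∑ k, q k * Real.exp (ℓ k h) with hS
  have hexp : ∀ k, ContDiff ℝ 3 fun h => Real.exp (ℓ k h) := fun k => by fun_prop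
  have hSd : ContDiff ℝ 3 S := by
    rw [hS]; fun_prop
  have hSpos : range S ⊆ Ioi 0 := by
    rintro _ ⟨h, rfl⟩
    obtain ⟨k, -, hk⟩ : ∃ k ∈ Finset.univ, 0 < q k := by
      by_contra! hcon
      have := Finset.sum_nonpos hcon
      linarith
    exact Finset.sum_pos' (fun k _ => mul_nonneg (hq k) (Real.exp_pos _).le)
      ⟨k, Finset.mem_univ k, mul_pos hk (Real.exp_pos _)⟩
  have hS0 : S 0 = 1 := by simp [hS, hq1]
  have hSD : ∀ j, 1 ≤ j → j ≤ i → ‖iteratedFDeriv ℝ j S 0‖ ≤ β ^ j := by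
    intro j hj hji
    have hj3 : (j : WithTop ℕ∞) ≤ 3 := by exact_mod_cast hji.trans hi3
    have h1 : iteratedFDeriv ℝ j S 0
        = ∑ k, q k • iteratedFDeriv ℝ j (fun h => Real.exp (ℓ k h)) 0 := by
      rw [hS, iteratedFDeriv_fun_sum_apply
        fun k _ => (((contDiff_const (c := q k)).mul (hexp k)).of_le hj3).contDiffAt]
      refine Finset.sum_congr rfl fun k _ => ?_
      exact iteratedFDeriv_const_smul_apply (a := q k) ((hexp k).of_le hj3).contDiffAt
    rw [h1]
    calc _ ≤ ∑ k, q k * β ^ j := by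
          refine norm_sum_le_of_le _ fun k _ => ?_
          rw [norm_smul, Real.norm_of_nonneg (hq k)]
          refine mul_le_mul_of_nonneg_left ?_ (hq k)
          refine (norm_iteratedFDeriv_exp_comp_le (ℓ k) j).trans ?_
          gcongr
          exact hℓ k
      _ = β ^ j := by rw [← Finset.sum_mul, hq1, one_mul]
  set A := ∑ i ∈ Finset.range 4, ‖iteratedFDerivWithin ℝ i Real.log (Ioi 0) 1‖ with hA
  have hA0 : 0 ≤ A := Finset.sum_nonneg fun _ _ => norm_nonneg _
  have hlog : ContDiffOn ℝ 3 Real.log (Ioi 0) :=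
    Real.contDiffOn_log.mono fun x hx => (ne_of_gt hx : x ≠ 0)
  have key := norm_iteratedFDeriv_comp_le' hSpos (uniqueDiffOn_Ioi 0) hlog hSd
    (by exact_mod_cast hi3 : (i : WithTop ℕ∞) ≤ 3) 0 (C := A) (D := β) (fun j hj => by
      rw [hS0]
      exact Finset.single_le_sum
        (f := fun i => ‖iteratedFDerivWithin ℝ i Real.log (Ioi 0) 1‖) (fun _ _ => norm_nonneg _)
        (Finset.mem_range.2 (by omega))) hSD
  refine key.trans ?_
  have h6 : (i.factorial : ℝ) ≤ 6 := by exact_mod_cast Nat.factorial_le hi3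
  calc _ ≤ (6 * A + 1) * β ^ i := by
        gcongr
        nlinarith
    _ ≤ (6 * A + 1) ^ i * β ^ i := by
        gcongr
        exact le_self_pow₀ (by linarith) (by omega)
    _ = (logSumExpConst * β) ^ i := by
        rw [← mul_pow, logSumExpConst]

/-- The `i`-th derivative of `logSumExp` with parameter `β = b ^ 3` is of order `β ^ (i - 1)`
uniformly in the size of `ι`. For `1 ≤ i ≤ 3` this is at most `(b ^ 2) ^ i`, with equality of
exponents for `i = 3`, so nothing is lost for the third derivative. -/
theorem norm_iteratedFDeriv_logSumExp_le [Nonempty ι] {b : ℝ} (hb : 1 ≤ b) (hℓ : ∀ k, ‖ℓ k‖ ≤ 1)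
    {i : ℕ} (hi : 1 ≤ i) (hi3 : i ≤ 3) (w : E) :
    ‖iteratedFDeriv ℝ i (fun w => logSumExp (b ^ 3) fun k => ℓ k w - a k) w‖
      ≤ (logSumExpConst * b ^ 2) ^ i := by
  set β := b ^ 3 with hβ
  have hb0 : 0 < b := by linarith
  have hβ0 : 0 < β := by positivity
  -- Near `w` the function is a constant plus `β⁻¹ log ∑ qₖ exp (β ℓₖ(h))` with the weights `qₖ` of
  -- the softmax at `w`, which add up to `1`.
  set T := ∑ k, Real.exp (β * (ℓ k w - a k)) with hT
  have hT0 : 0 < T := sum_exp_pos _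
  set q : ι → ℝ := fun k => Real.exp (β * (ℓ k w - a k)) / T with hq
  set H : E → ℝ := fun h => Real.log (∑ k, q k * Real.exp ((β • ℓ k) h)) with hH
  have hqpos : ∀ k, 0 < q k := fun k => div_pos (Real.exp_pos _) hT0
  have hsum : ∀ h, 0 < ∑ k, q k * Real.exp ((β • ℓ k) h) := fun h =>
    Finset.sum_pos (fun k _ => mul_pos (hqpos k) (Real.exp_pos _)) Finset.univ_nonempty
  have hHd : ContDiff ℝ 3 H := by
    refine ContDiff.log ?_ fun h => (hsum h).ne'
    fun_prop
  have hi3' : (i : WithTop ℕ∞) ≤ 3 := by exact_mod_cast hi3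
  have heq : (fun h => logSumExp β fun k => ℓ k (w + h) - a k)
      = (fun h => β⁻¹ * Real.log T) + β⁻¹ • H := by
    funext h
    simp only [logSumExp, Pi.add_apply, Pi.smul_apply, smul_eq_mul, ← mul_add, hH]
    rw [← Real.log_mul hT0.ne' (hsum h).ne', Finset.mul_sum]
    congr 3 with k
    rw [hq, ← mul_assoc, mul_div_cancel₀ _ hT0.ne', ← Real.exp_add]
    simp only [map_add, smul_apply, smul_eq_mul]
    ring_nf
  have h0 := iteratedFDeriv_comp_add_left (𝕜 := ℝ)
    (f := fun w => logSumExp β fun k => ℓ k w - a k) i w 0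
  rw [add_zero] at h0
  have hHd' : ContDiffAt ℝ i (β⁻¹ • H) 0 := ((hHd.const_smul β⁻¹).of_le hi3').contDiffAt
  rw [← h0, heq, iteratedFDeriv_add_apply contDiffAt_const hHd',
    iteratedFDeriv_const_of_ne (by omega)]
  have h2 := iteratedFDeriv_const_smul_apply (𝕜 := ℝ) (a := β⁻¹) (x := (0 : E))
    (hHd.of_le hi3').contDiffAt
  rw [Pi.zero_apply, zero_add, h2, norm_smul, norm_inv, Real.norm_of_nonneg hβ0.le]
  have h3 := norm_iteratedFDeriv_log_weighted_sum_exp_le (fun k => β • ℓ k) hβ0.le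
    (fun k => (hqpos k).le)
    (by rw [hq, ← Finset.sum_div, div_self hT0.ne'])
    (fun k => by
      rw [norm_smul, Real.norm_of_nonneg hβ0.le]
      exact mul_le_of_le_one_right hβ0.le (hℓ k)) hi hi3
  have hκ := one_le_logSumExpConst
  rw [inv_mul_le_iff₀ hβ0]
  refine h3.trans ?_
  have h4 : β ^ i ≤ β * (b ^ 2) ^ i := by
    rw [hβ, ← pow_mul, ← pow_mul, ← pow_add]
    exact pow_le_pow_right₀ hb (by omega)
  calc _ = logSumExpConst ^ i * β ^ i := mul_pow _ _ _
    _ ≤ logSumExpConst ^ i * (β * (b ^ 2) ^ i) := by gcongr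
    _ = _ := by rw [mul_pow]; ring

end SmoothMaximum

/-! ### The norm of the class `M⁰` -/

section NormM0

variable {E : Type*} [NormedAddCommGroup E] [NormedSpace ℝ E]

theorem norm_fderiv_fderiv_eq (g : E → ℝ) (w : E) :
    ‖fderiv ℝ (fderiv ℝ g) w‖ = ‖iteratedFDeriv ℝ 2 g w‖ := by
  rw [← norm_iteratedFDeriv_one, norm_iteratedFDeriv_fderiv]

set_option maxSynthPendingDepth 3 in
theorem norm_fderiv_fderiv_fderiv_eq (g : E → ℝ) (w : E) :
    ‖fderiv ℝ (fderiv ℝ (fderiv ℝ g)) w‖ = ‖iteratedFDeriv ℝ 3 g w‖ := by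
  rw [← norm_iteratedFDeriv_one, norm_iteratedFDeriv_fderiv, norm_iteratedFDeriv_fderiv]

theorem sphereSup_le {p : ℕ} {q : CadlagPath p → ℝ} {K : ℝ} (h : ∀ u, ‖u‖ = 1 → |q u| ≤ K) :
    sphereSup q ≤ ENNReal.ofReal K :=
  iSup₂_le fun u hu => by
    rw [Real.enorm_eq_ofReal_abs]
    exact ENNReal.ofReal_le_ofReal (h u hu)

set_option maxSynthPendingDepth 3 in
/-- The second derivative is Lipschitz because the third one is bounded. -/
theorem HasDerivBounds.memM0 {p : ℕ} {c B : ℝ} {g : CadlagPath p → ℝ} (hB : 1 ≤ B)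
    (h : HasDerivBounds c B g) : MemM0 g ∧ normM0 g ≤ ENNReal.ofReal (4 * (c * B ^ 3)) := by
  set K := c * B ^ 3 with hK
  have hc := h.nonneg
  have hK0 : 0 ≤ K := by positivity
  have hle : ∀ i ≤ 3, ∀ w, ‖iteratedFDeriv ℝ i g w‖ ≤ K := fun i hi w =>
    (h.norm_le i hi w).trans (mul_le_mul_of_nonneg_left (pow_le_pow_right₀ hB hi) hc)
  have hd1 : ContDiff ℝ 2 (fderiv ℝ g) := h.contDiff.fderiv_right (by norm_num)
  have hd2 : ContDiff ℝ 1 (fderiv ℝ (fderiv ℝ g)) := hd1.fderiv_right (by norm_num)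
  have h0 : ∀ w, |g w| ≤ K := fun w => by simpa using hle 0 (by norm_num) w
  have h1 : ∀ w, derivNorm g w ≤ ENNReal.ofReal K := fun w => sphereSup_le fun u hu => by
    have := (fderiv ℝ g w).le_opNorm u
    rw [hu, mul_one] at this
    refine this.trans ?_
    rw [← norm_iteratedFDeriv_one]
    exact hle 1 (by norm_num) w
  have h2 : ∀ w, secondDerivNorm g w ≤ ENNReal.ofReal K := fun w => sphereSup_le fun u hu => by
    have := (fderiv ℝ (fderiv ℝ g) w).le_opNorm₂ u u
    rw [hu, mul_one, mul_one] at this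
    refine this.trans ?_
    rw [norm_fderiv_fderiv_eq]
    exact hle 2 (by norm_num) w
  have h3 : ∀ w v, secondDerivDiffNorm g w v ≤ ENNReal.ofReal (K * ‖v‖) := fun w v =>
    sphereSup_le fun u hu => by
      have := (fderiv ℝ (fderiv ℝ g) (w + v) - fderiv ℝ (fderiv ℝ g) w).le_opNorm₂ u u
      rw [hu, mul_one, mul_one] at this
      refine this.trans ?_
      have h4 := convex_univ.norm_image_sub_le_of_norm_fderiv_le (𝕜 := ℝ) (C := K)
        (f := fderiv ℝ (fderiv ℝ g)) (fun x _ => hd2.differentiable one_ne_zero x)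
        (fun x _ => (norm_fderiv_fderiv_fderiv_eq g x).trans_le (hle 3 le_rfl x))
        (mem_univ w) (mem_univ (w + v))
      simpa using h4
  have hnorm : normM0 g ≤ ENNReal.ofReal (4 * K) := by
    have h4 : ∀ w v : CadlagPath p, v ≠ 0 →
        secondDerivDiffNorm g w v / ‖v‖ₑ ≤ ENNReal.ofReal K := fun w v hv => by
      refine ENNReal.div_le_of_le_mul ((h3 w v).trans_eq ?_)
      rw [ENNReal.ofReal_mul hK0, ofReal_norm]
    calc normM0 g ≤ ENNReal.ofReal K + ENNReal.ofReal K + ENNReal.ofReal K + ENNReal.ofReal K := by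
          refine add_le_add (add_le_add (add_le_add (iSup_le fun w => ?_) (iSup_le h1))
            (iSup_le h2)) (iSup_le fun w => iSup₂_le fun v hv => h4 w v hv)
          rw [Real.enorm_eq_ofReal_abs]
          exact ENNReal.ofReal_le_ofReal (h0 w)
      _ = _ := by
          rw [← ENNReal.ofReal_add hK0 hK0, ← ENNReal.ofReal_add (by positivity) hK0,
            ← ENNReal.ofReal_add (by positivity) hK0]
          ring_nf
  refine ⟨⟨⟨h.contDiff.continuous, ⟨K, fun w => ?_⟩, h.contDiff.differentiable (by norm_num),
    hd1.differentiable (by norm_num), ⟨K, h3⟩⟩, hnorm.trans_lt ENNReal.ofReal_lt_top⟩, hnorm⟩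
  exact (div_le_self (abs_nonneg _) (le_add_of_nonneg_right (by positivity))).trans (h0 w)

end NormM0

/-! ### The Skorokhod topology near continuous functions -/

namespace SkorokhodSpace

variable {p : ℕ}

theorem exists_timeChange {w v : SkorokhodSpace p} {ε : ℝ} (h : dist w v < ε) :
    ∃ lam : I ≃o I, (∀ t : I, dist (lam t) t < ε) ∧
      ∀ t : I, ‖w.toCadlag t - v.toCadlag (lam t)‖ < ε := by
  obtain ⟨lam, hlam⟩ := exists_lt_of_ciInf_lt (f := timeChangeCost w v) h
  exact ⟨lam, fun t => (abs_le_cost w v lam t).trans_lt hlam,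
    fun t => (norm_le_cost w v lam t).trans_lt hlam⟩

theorem dist_le_norm_sub (w v : SkorokhodSpace p) : dist w v ≤ ‖w.toCadlag - v.toCadlag‖ :=
  (ciInf_le (bddBelow_cost w v) (OrderIso.refl I)).trans <|
    cost_le (fun t => by simp) fun t => CadlagPath.norm_apply_le (w.toCadlag - v.toCadlag) t

/-- The inverse of `toCadlag`: a càdlàg function as a point of the Skorokhod space. -/
def ofCadlag (w : CadlagPath p) : SkorokhodSpace p := w

theorem isClosed_forall_Ioo_mem (s t : I) {A : Set (EuclideanSpace ℝ (Fin p))} (hA : IsClosed A) :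
    IsClosed {w : SkorokhodSpace p | ∀ u ∈ Ioo s t, w.toCadlag u ∈ A} := by
  refine isClosed_of_closure_subset fun w hw u hu => ?_
  rw [← hA.closure_eq, Metric.mem_closure_iff]
  intro ε hε
  have hs : 0 < dist u s := dist_pos.2 hu.1.ne'
  have ht : 0 < dist u t := dist_pos.2 hu.2.ne
  obtain ⟨v, hv, hwv⟩ := Metric.mem_closure_iff.1 hw (min ε (min (dist u s) (dist u t)))
    (by positivity)
  obtain ⟨lam, h1, h2⟩ := exists_timeChange hwv
  have h1 := h1 u
  refine ⟨v.toCadlag (lam u), hv _ ?_, ?_⟩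
  · have hs' : dist (lam u) u < dist u s := h1.trans_le ((min_le_right _ _).trans (min_le_left _ _))
    have ht' : dist (lam u) u < dist u t :=
      h1.trans_le ((min_le_right _ _).trans (min_le_right _ _))
    have hu1 : (s : ℝ) < u := hu.1
    have hu2 : (u : ℝ) < t := hu.2
    rw [Subtype.dist_eq, Subtype.dist_eq, Real.dist_eq, Real.dist_eq,
      abs_lt] at hs' ht'
    rw [abs_of_pos (by linarith)] at hs'
    rw [abs_of_neg (by linarith)] at ht'
    constructor
    · rw [← Subtype.coe_lt_coe]; linarith
    · rw [← Subtype.coe_lt_coe]; linarith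
  · rw [dist_eq_norm]
    exact (h2 u).trans_le (min_le_left _ _)

theorem isClosed_apply_one_mem {A : Set (EuclideanSpace ℝ (Fin p))} (hA : IsClosed A) :
    IsClosed {w : SkorokhodSpace p | w.toCadlag 1 ∈ A} := by
  refine isClosed_of_closure_subset fun w hw => ?_
  rw [mem_ofPred_eq, ← hA.closure_eq, Metric.mem_closure_iff]
  intro ε hε
  obtain ⟨v, hv, hwv⟩ := Metric.mem_closure_iff.1 hw ε hε
  obtain ⟨lam, -, h2⟩ := exists_timeChange hwv
  have h := h2 1
  rw [show lam 1 = 1 from lam.map_top] at h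
  exact ⟨_, hv, by rwa [dist_eq_norm]⟩

/-- Evaluation at `t` is Borel measurable for the Skorokhod topology, although it is not
continuous in general. By right continuity, `w t i > a` holds exactly if `w · i ≥ a + ε` on some
interval `(t, s)`, with `ε > 0`, and the latter is a closed condition on `w`. -/
theorem measurable_apply (t : I) (i : Fin p) :
    Measurable fun w : SkorokhodSpace p => w.toCadlag t i := by
  have hA : ∀ c : ℝ, IsClosed {y : EuclideanSpace ℝ (Fin p) | c ≤ y i} := fun c =>
    isClosed_le continuous_const (by fun_prop)
  refine measurable_of_Ioi fun a => ?_
  rcases (le_top : t ≤ ⊤).eq_or_lt with rfl | ht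
  · -- Time changes fix the end point, so evaluation there is continuous.
    have : (fun w : SkorokhodSpace p => w.toCadlag ⊤ i) ⁻¹' Ioi a
        = ⋃ k : ℕ, {w | w.toCadlag 1 ∈ {y : EuclideanSpace ℝ (Fin p) | a + 1 / (k + 1) ≤ y i}} := by
      ext w
      simp only [mem_preimage, mem_Ioi, mem_iUnion, mem_ofPred_eq]
      constructor
      · intro h
        obtain ⟨k, hk⟩ := exists_nat_one_div_lt (sub_pos.2 h)
        exact ⟨k, (by linarith : a + 1 / ((k : ℝ) + 1) ≤ w.toCadlag ⊤ i)⟩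
      · rintro ⟨k, hk⟩
        have : (0 : ℝ) < 1 / (k + 1) := by positivity
        exact (by linarith : a < w.toCadlag 1 i)
    rw [this]
    exact MeasurableSet.iUnion fun k => (isClosed_apply_one_mem (hA _)).measurableSet
  · obtain ⟨u, -, hu, hut⟩ := exists_seq_strictAnti_tendsto' ht
    have : (fun w : SkorokhodSpace p => w.toCadlag t i) ⁻¹' Ioi a
        = ⋃ k : ℕ, ⋃ m : ℕ, {w | ∀ s ∈ Ioo t (u m),
          w.toCadlag s ∈ {y : EuclideanSpace ℝ (Fin p) | a + 1 / (k + 1) ≤ y i}} := by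
      ext w
      have hright : Tendsto (fun s => w.toCadlag s i) (𝓝[≥] t) (𝓝 (w.toCadlag t i)) :=
        ((EuclideanSpace.proj (𝕜 := ℝ) i).continuous.tendsto _).comp
          (w.toCadlag.right_continuous t)
      simp only [mem_preimage, mem_Ioi, mem_iUnion, mem_ofPred_eq]
      constructor
      · intro h
        obtain ⟨k, hk⟩ := exists_nat_one_div_lt (sub_pos.2 h)
        have h1 : ∀ᶠ s in 𝓝[≥] t, a + 1 / (k + 1) < w.toCadlag s i :=
          hright.eventually (lt_mem_nhds (by linarith))
        obtain ⟨y, hy, hy'⟩ := (mem_nhdsGE_iff_exists_Ico_subset' ht).1 h1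
        obtain ⟨m, hm⟩ := (hut.eventually (gt_mem_nhds hy)).exists
        exact ⟨k, m, fun s hs => (hy' ⟨hs.1.le, hs.2.trans hm⟩).le⟩
      · rintro ⟨k, m, hkm⟩
        have : (0 : ℝ) < 1 / (k + 1) := by positivity
        refine (by linarith : a < a + 1 / ((k : ℝ) + 1)).trans_le ?_
        have : (𝓝[>] t).NeBot := nhdsGT_neBot_of_exists_gt ⟨_, ht⟩
        refine ge_of_tendsto (hright.mono_left (nhdsWithin_mono t Ioi_subset_Ici_self)) ?_
        filter_upwards [Ioo_mem_nhdsGT (hu m).1] with s hs using hkm s hs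
    rw [this]
    exact MeasurableSet.iUnion fun k => MeasurableSet.iUnion fun m =>
      (isClosed_forall_Ioo_mem _ _ (hA _)).measurableSet

/-- A ball of the supremum norm is open for the Skorokhod topology if its centre is a
continuous function: small time changes hardly alter the centre. -/
theorem isOpen_norm_sub_lt {x : CadlagPath p} (hx : Continuous x) (δ : ℝ) :
    IsOpen {w : SkorokhodSpace p | ‖w.toCadlag - x‖ < δ} := by
  refine Metric.isOpen_iff.2 fun w hw => ?_
  rw [mem_ofPred_eq] at hw
  set η := (δ - ‖w.toCadlag - x‖) / 3 with hη
  have hη0 : 0 < η := by rw [hη]; linarith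
  obtain ⟨ρ, hρ, hxρ⟩ := Metric.uniformContinuous_iff.1
    (CompactSpace.uniformContinuous_of_continuous hx) η hη0
  refine ⟨min η ρ, lt_min hη0 hρ, fun v hv => ?_⟩
  obtain ⟨lam, h1, h2⟩ := exists_timeChange (Metric.mem_ball.1 hv)
  refine (CadlagPath.norm_le (B := δ - η) fun t => ?_).trans_lt (by linarith)
  have h3 := (h2 t).trans_le (min_le_left _ _)
  have h4 := hxρ ((h1 t).trans_le (min_le_right _ _))
  have h5 := CadlagPath.norm_apply_le (w.toCadlag - x) (lam t)
  rw [CadlagPath.sub_apply] at h5 ⊢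
  rw [dist_eq_norm] at h4
  calc ‖v.toCadlag t - x t‖ = ‖(v.toCadlag t - w.toCadlag (lam t))
        + (w.toCadlag (lam t) - x (lam t)) + (x (lam t) - x t)‖ := by congr 1; abel
    _ ≤ _ := norm_add₃_le
    _ ≤ δ - η := by linarith

theorem continuousAt_toCadlag {x : SkorokhodSpace p} (hx : Continuous x.toCadlag) :
    ContinuousAt toCadlag x := by
  refine Metric.tendsto_nhds.2 fun ε hε => ?_
  filter_upwards [(isOpen_norm_sub_lt hx ε).mem_nhds (by simpa using hε)] with w hw
  rwa [dist_eq_norm]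

theorem isClosed_setOf_continuous : IsClosed {w : SkorokhodSpace p | Continuous w.toCadlag} := by
  refine isClosed_of_closure_subset fun w hw => ?_
  refine continuous_of_uniform_approx_of_continuous fun u hu => ?_
  obtain ⟨ε, hε, hεu⟩ := Metric.mem_uniformity_dist.1 hu
  obtain ⟨v, hv, hwv⟩ := Metric.mem_closure_iff.1 hw ε hε
  obtain ⟨lam, -, h2⟩ := exists_timeChange hwv
  exact ⟨fun t => v.toCadlag (lam t), Continuous.comp hv lam.continuous, fun t => hεu (by
    rw [dist_eq_norm]; exact h2 t)⟩

/-- `toCadlag` need not be Borel measurable, but it is continuous on the closed set of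
continuous paths. -/
theorem aemeasurable_toCadlag {Ω : Type*} [MeasurableSpace Ω] {P : Measure Ω}
    {Z : Ω → SkorokhodSpace p} (hZm : AEMeasurable Z P)
    (hZ : ∀ᵐ ω ∂P, Continuous (Z ω).toCadlag) : AEMeasurable (fun ω => (Z ω).toCadlag) P := by
  have hC := (isClosed_setOf_continuous (p := p)).measurableSet
  have h : AEMeasurable (toCadlag : SkorokhodSpace p → CadlagPath p) (P.map Z) := by
    rw [← Measure.restrict_eq_self_of_ae_mem
      (s := {w : SkorokhodSpace p | Continuous w.toCadlag}) ((ae_map_iff hZm hC).2 hZ)]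
    exact ContinuousOn.aemeasurable
      (fun x hx => (continuousAt_toCadlag hx).continuousWithinAt) hC
  exact h.comp_aemeasurable hZm

end SkorokhodSpace

/-! ### Paths on a grid -/

section Grid

variable {p : ℕ}

/-- The point `j / N` of `[0,1]`. -/
def gridPoint (N : ℕ) (j : Fin (N + 1)) : I :=
  ⟨j / N, by positivity, div_le_one_of_le₀ (by exact_mod_cast Nat.lt_succ_iff.1 j.2)
    (by positivity)⟩

theorem exists_gridPoint_le {N : ℕ} (hN : 0 < N) (t : I) :
    ∃ j : Fin (N + 1), (gridPoint N j : ℝ) ≤ t ∧ (t : ℝ) < gridPoint N j + 1 / N := by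
  have hN' : (0 : ℝ) < N := by exact_mod_cast hN
  have h0 : (0 : ℝ) ≤ t * N := mul_nonneg t.2.1 hN'.le
  have hle : ⌊(t : ℝ) * N⌋₊ ≤ N := by
    rw [← Nat.cast_le (α := ℝ)]
    exact (Nat.floor_le h0).trans (mul_le_of_le_one_left hN'.le t.2.2)
  refine ⟨⟨⌊(t : ℝ) * N⌋₊, Nat.lt_succ_iff.2 hle⟩, ?_, ?_⟩
  · exact (div_le_iff₀ hN').2 (Nat.floor_le h0)
  · change (t : ℝ) < _ / _ + 1 / N
    rw [← add_div, lt_div_iff₀ hN']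
    exact Nat.lt_floor_add_one _

/-- Every value of `w` is within `η` of a value at a point of the grid with mesh `1 / N`, at
distance at most `1 / N`. -/
def GridRegular (N : ℕ) (η : ℝ) (w : CadlagPath p) : Prop :=
  ∀ t : I, ∃ j : Fin (N + 1), dist (gridPoint N j) t ≤ 1 / N ∧ ‖w t - w (gridPoint N j)‖ ≤ η

theorem IsPiecewiseConstant.le_one {w : CadlagPath p} {r : ℝ} (h : IsPiecewiseConstant w r)
    (hr : 0 < r) : r ≤ 1 := by
  obtain ⟨m, a, ha0, ham, ha⟩ := h
  have key : ∀ k ≤ m, k ≠ 0 → r ≤ a k := by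
    intro k
    induction k with
    | zero => exact fun _ h => absurd rfl h
    | succ k ih =>
      intro hk _
      have h1 := (ha k (by omega)).2.1
      rcases eq_or_ne k 0 with rfl | h0
      · linarith
      · have := ih (by omega) h0
        linarith
  rw [← ham]
  refine key m le_rfl ?_
  rintro rfl
  linarith

theorem IsPiecewiseConstant.gridRegular {w : CadlagPath p} {r : ℝ} (h : IsPiecewiseConstant w r)
    {N : ℕ} (hN : 0 < N) (hr : 1 / (N : ℝ) ≤ r) {η : ℝ} (hη : 0 ≤ η) : GridRegular N η w := by
  obtain ⟨m, a, ha0, ham, ha⟩ := h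
  have hN' : (0 : ℝ) < N := by exact_mod_cast hN
  intro t
  obtain ⟨j, hj, hj'⟩ := exists_gridPoint_le hN t
  -- The value at `1` is free, but `1` is a grid point.
  rcases t.2.2.eq_or_lt with ht | ht
  · refine ⟨Fin.last N, ?_⟩
    have : gridPoint N (Fin.last N) = t := Subtype.ext (by simp [gridPoint, ht, hN'.ne'])
    rw [this]
    simpa using hη
  obtain ⟨k, hk, hkt, hkt'⟩ : ∃ k < m, a k ≤ t ∧ (t : ℝ) < a (k + 1) := by
    by_contra! hcon
    have : ∀ k ≤ m, a k ≤ t := by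
      intro k
      induction k with
      | zero => exact fun _ => ha0.trans_le t.2.1
      | succ k ih => exact fun hk => hcon k hk (ih (by omega))
    linarith [this m le_rfl]
  obtain ⟨-, hrk, hconst⟩ := ha k hk
  suffices ∃ j : Fin (N + 1), |(gridPoint N j : ℝ) - t| ≤ 1 / N ∧
      (gridPoint N j : ℝ) ∈ Ico (a k) (a (k + 1)) by
    obtain ⟨j, h1, h2⟩ := this
    refine ⟨j, h1, ?_⟩
    rw [hconst t _ ⟨hkt, hkt'⟩ h2]
    simpa using hη
  -- The last grid point before `t` may precede `a k`; then the next one is still below `a (k + 1)`,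
  -- because the interval has length at least `1 / N`.
  rcases le_or_gt (a k) (gridPoint N j) with h1 | h1
  · exact ⟨j, abs_le.2 ⟨by linarith, by linarith [one_div_pos.2 hN']⟩, h1, hj.trans_lt hkt'⟩
  · have hjN : (j : ℕ) + 1 < N + 1 := by
      have : ((j : ℕ) : ℝ) / N < 1 := hj.trans_lt ht
      rw [div_lt_one hN'] at this
      have : (j : ℕ) < N := by exact_mod_cast this
      omega
    have hval : (gridPoint N ⟨j + 1, hjN⟩ : ℝ) = gridPoint N j + 1 / N := by
      simp [gridPoint, add_div]
    refine ⟨⟨j + 1, hjN⟩, ?_⟩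
    rw [hval]
    exact ⟨abs_le.2 ⟨by linarith [one_div_pos.2 hN'], by linarith⟩, by linarith, by linarith⟩

theorem gridRegular_of_norm_sub_le {w x : CadlagPath p} {N : ℕ} (hN : 0 < N) {δ : ℝ}
    (hx : ∀ s t, dist s t ≤ 1 / (N : ℝ) → ‖x s - x t‖ ≤ δ) (hwx : ‖w - x‖ ≤ δ) :
    GridRegular N (3 * δ) w := by
  intro t
  obtain ⟨j, hj, hj'⟩ := exists_gridPoint_le hN t
  have hd : dist (gridPoint N j) t ≤ 1 / N := by
    rw [Subtype.dist_eq, Real.dist_eq]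
    exact abs_le.2 ⟨by linarith, by linarith [show (0 : ℝ) ≤ 1 / N by positivity]⟩
  refine ⟨j, hd, ?_⟩
  have h1 := (CadlagPath.norm_apply_le (w - x) t).trans hwx
  have h2 := (CadlagPath.norm_apply_le (w - x) (gridPoint N j)).trans hwx
  have h3 := hx t (gridPoint N j) (by rwa [dist_comm])
  rw [CadlagPath.sub_apply] at h1 h2
  rw [norm_sub_rev] at h2
  calc _ = ‖(w t - x t) + (x t - x (gridPoint N j)) + (x (gridPoint N j) - w (gridPoint N j))‖ := by
        congr 1; abel
    _ ≤ _ := norm_add₃_le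
    _ ≤ 3 * δ := by linarith

/-- The `i`-th coordinate of the value at `t`, as a continuous linear functional. -/
def coordEval (t : I) (i : Fin p) : CadlagPath p →L[ℝ] ℝ :=
  LinearMap.mkContinuous
    { toFun := fun w => w t i
      map_add' := fun _ _ => rfl
      map_smul' := fun _ _ => rfl } 1 fun w => by
    rw [one_mul]
    exact (PiLp.norm_apply_le (w t) i).trans (w.norm_apply_le t)

@[simp] theorem coordEval_apply (t : I) (i : Fin p) (w : CadlagPath p) :
    coordEval t i w = w t i := rfl

theorem norm_coordEval_le (t : I) (i : Fin p) : ‖coordEval t i‖ ≤ 1 :=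
  LinearMap.mkContinuous_norm_le _ zero_le_one _

/-- The index set of the functionals `0` and `w ↦ ± wᵢ(j / N)`. The index `none` stands for `0`; it
makes the set nonempty also for `p = 0`. -/
abbrev GridIndex (N p : ℕ) : Type := Option ((Fin (N + 1) × Fin p) × Bool)

/-- The functionals `0` and `w ↦ ± wᵢ(j / N)`, whose maximum is `max |wᵢ(j / N)|`. -/
def gridFunctional {N : ℕ} : GridIndex N p → CadlagPath p →L[ℝ] ℝ
  | none => 0
  | some ((j, i), true) => coordEval (gridPoint N j) i
  | some ((j, i), false) => -coordEval (gridPoint N j) i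

theorem norm_gridFunctional_le {N : ℕ} (k : GridIndex N p) : ‖gridFunctional k‖ ≤ 1 := by
  rcases k with _ | ⟨⟨j, i⟩, _ | _⟩
  · simp [gridFunctional]
  · simpa [gridFunctional] using norm_coordEval_le _ _
  · exact norm_coordEval_le _ _

theorem card_gridIndex (N p : ℕ) : Fintype.card (GridIndex N p) = (N + 1) * p * 2 + 1 := by
  simp

/-- A smooth version of `max |wᵢ(j / N) - xᵢ(j / N)|`, the maximum being over all grid points and
coordinates. -/
def smoothDist (N : ℕ) (β : ℝ) (x w : CadlagPath p) : ℝ :=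
  logSumExp β fun k : GridIndex N p => gridFunctional k w - gridFunctional k x

variable {N : ℕ} {β : ℝ}

theorem smoothDist_nonneg (hβ : 0 < β) (x w : CadlagPath p) : 0 ≤ smoothDist N β x w := by
  refine (le_of_eq ?_).trans
    (le_logSumExp hβ (fun k : GridIndex N p => gridFunctional k w - gridFunctional k x) none)
  simp [gridFunctional]

theorem abs_apply_sub_le_smoothDist (hβ : 0 < β) (x w : CadlagPath p) (j : Fin (N + 1))
    (i : Fin p) : |w (gridPoint N j) i - x (gridPoint N j) i| ≤ smoothDist N β x w := by
  have h := le_logSumExp hβ (fun k : GridIndex N p => gridFunctional k w - gridFunctional k x)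
  refine abs_le'.2 ⟨h (some ((j, i), true)), ?_⟩
  have h' := h (some ((j, i), false))
  simp only [gridFunctional, neg_apply, coordEval_apply] at h'
  exact le_trans (by linarith) h'

theorem smoothDist_le (hβ : 0 < β) (x w : CadlagPath p) :
    smoothDist N β x w ≤ ‖w - x‖ + Real.log (Fintype.card (GridIndex N p)) / β := by
  refine logSumExp_le hβ fun k => ?_
  rw [← map_sub]
  refine (le_abs_self _).trans (((gridFunctional k).le_opNorm _).trans ?_)
  exact mul_le_of_le_one_left (norm_nonneg _) (norm_gridFunctional_le k)

theorem norm_sub_le_of_smoothDist_le (hβ : 0 < β) {x w : CadlagPath p} {δ : ℝ}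
    (hx : ∀ s t, dist s t ≤ 1 / (N : ℝ) → ‖x s - x t‖ ≤ δ) (hw : GridRegular N (3 * δ) w)
    (h : smoothDist N β x w ≤ 3 * δ) : ‖w - x‖ ≤ (3 * p + 4) * δ := by
  refine CadlagPath.norm_le fun t => ?_
  obtain ⟨j, hj, hj'⟩ := hw t
  have h1 := hx _ _ hj
  have h2 : ‖w (gridPoint N j) - x (gridPoint N j)‖ ≤ p * (3 * δ) := by
    rw [EuclideanSpace.norm_eq]
    refine (Real.sqrt_le_sqrt (Finset.sum_sq_le_sq_sum_of_nonneg (f := fun i =>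
      ‖(w (gridPoint N j) - x (gridPoint N j)) i‖) fun _ _ => norm_nonneg _)).trans ?_
    rw [Real.sqrt_sq (Finset.sum_nonneg fun _ _ => norm_nonneg _)]
    refine (Finset.sum_le_card_nsmul _ _ (3 * δ) fun i _ =>
      (abs_apply_sub_le_smoothDist hβ x w j i).trans h).trans_eq (by simp)
  rw [CadlagPath.sub_apply]
  calc _ = ‖(w t - w (gridPoint N j)) + (w (gridPoint N j) - x (gridPoint N j))
        + (x (gridPoint N j) - x t)‖ := by congr 1; abel
    _ ≤ _ := norm_add₃_le
    _ ≤ (3 * p + 4) * δ := by linarith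

theorem measurable_smoothDist (x : CadlagPath p) :
    Measurable fun w : SkorokhodSpace p => smoothDist N β x w.toCadlag := by
  have h : ∀ k : GridIndex N p,
      Measurable fun w : SkorokhodSpace p => gridFunctional k w.toCadlag := by
    rintro (_ | ⟨⟨j, i⟩, _ | _⟩)
    · exact measurable_const
    · exact (SkorokhodSpace.measurable_apply _ _).neg
    · exact SkorokhodSpace.measurable_apply _ _
  unfold smoothDist logSumExp
  exact (Real.measurable_log.comp (Finset.measurable_sum _ fun k _ =>
    Real.measurable_exp.comp (((h k).sub_const _).const_mul β))).const_mul _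

/-- The constant `6 * A` depends only on `ψ`, and `B = logSumExpConst * b ^ 2` does not involve
the number of grid points. -/
theorem hasDerivBounds_comp_smoothDist {ψ : ℝ → ℝ} {A : ℝ} (hψ : ContDiff ℝ 3 ψ)
    (hA : ∀ i ≤ 3, ∀ x, ‖iteratedFDeriv ℝ i ψ x‖ ≤ A) {b : ℝ} (hb : 1 ≤ b) (x : CadlagPath p) :
    HasDerivBounds (6 * A) (logSumExpConst * b ^ 2)
      (fun w => ψ (smoothDist N (b ^ 3) x w)) :=
  HasDerivBounds.comp hψ hA
    (mul_nonneg (zero_le_one.trans one_le_logSumExpConst) (sq_nonneg b))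
    (contDiff_logSumExp _ _) fun _ hi hi3 w =>
      norm_iteratedFDeriv_logSumExp_le _ _ hb norm_gridFunctional_le hi hi3 w

end Grid

/-! ### Successive convex combinations -/

section Blend

/-- The successive convex combinations of `y 0, y 1, …` with weights `φ 0, φ 1, …`: at step `l` the
value moves towards `y l` by the fraction `φ l`. The initial value `0` keeps the weight
`∏ l, (1 - φ l)`. -/
def blend (φ y : ℕ → ℝ) : ℕ → ℝ
  | 0 => 0
  | l + 1 => φ l * y l + (1 - φ l) * blend φ y l

variable {φ y : ℕ → ℝ} {M : ℝ}

theorem abs_blend_le (h0 : ∀ l, 0 ≤ φ l) (h1 : ∀ l, φ l ≤ 1) (hM : 0 ≤ M) (hy : ∀ l, |y l| ≤ M) :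
    ∀ L, |blend φ y L| ≤ M
  | 0 => by simpa [blend] using hM
  | L + 1 => by
    have ih := abs_blend_le h0 h1 hM hy L
    have h0 := h0 L
    have h1 := sub_nonneg.2 (h1 L)
    calc |blend φ y (L + 1)| ≤ |φ L * y L| + |(1 - φ L) * blend φ y L| := abs_add_le _ _
      _ = φ L * |y L| + (1 - φ L) * |blend φ y L| := by
          rw [abs_mul, abs_mul, abs_of_nonneg h0, abs_of_nonneg h1]
      _ ≤ φ L * M + (1 - φ L) * M := by gcongr; exact hy L
      _ = M := by ring

/-- Each step with a positive weight moves towards a number within `η` of `a`, and the initial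
value `0`, which is within `M` of `a`, keeps the weight `∏ l, (1 - φ l)`. -/
theorem abs_sub_blend_le (h0 : ∀ l, 0 ≤ φ l) (h1 : ∀ l, φ l ≤ 1) {a η : ℝ} (ha : |a| ≤ M)
    (hη : 0 ≤ η) (L : ℕ) (h : ∀ l < L, φ l ≠ 0 → |a - y l| ≤ η) :
    |a - blend φ y L| ≤ η + M * ∏ l ∈ Finset.range L, (1 - φ l) := by
  induction L with
  | zero => simpa [blend] using ha.trans (by linarith)
  | succ L ih =>
    have ih := ih fun l hl => h l (by omega)
    have h0' := h0 L
    have h1' := sub_nonneg.2 (h1 L)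
    have h2 : φ L * |a - y L| ≤ φ L * η := by
      by_cases hφ : φ L = 0
      · simp [hφ]
      · exact mul_le_mul_of_nonneg_left (h L (by omega) hφ) h0'
    rw [Finset.prod_range_succ]
    calc |a - blend φ y (L + 1)| = |φ L * (a - y L) + (1 - φ L) * (a - blend φ y L)| := by
          rw [blend]; ring_nf
      _ ≤ |φ L * (a - y L)| + |(1 - φ L) * (a - blend φ y L)| := abs_add_le _ _
      _ = φ L * |a - y L| + (1 - φ L) * |a - blend φ y L| := by
          rw [abs_mul, abs_mul, abs_of_nonneg h0', abs_of_nonneg h1']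
      _ ≤ φ L * η + (1 - φ L) * (η + M * ∏ l ∈ Finset.range L, (1 - φ l)) := by gcongr
      _ = _ := by ring

theorem prod_one_sub_mem_Icc (h0 : ∀ l, 0 ≤ φ l) (h1 : ∀ l, φ l ≤ 1) (L : ℕ) :
    ∏ l ∈ Finset.range L, (1 - φ l) ∈ Icc (0 : ℝ) 1 :=
  ⟨Finset.prod_nonneg fun l _ => sub_nonneg.2 (h1 l),
    Finset.prod_le_one (fun l _ => sub_nonneg.2 (h1 l)) fun l _ => by linarith [h0 l]⟩

variable {E : Type*} [NormedAddCommGroup E] [NormedSpace ℝ E]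

theorem HasDerivBounds.one_sub {c B : ℝ} {g : E → ℝ} (hB : 0 ≤ B) (h : HasDerivBounds c B g) :
    HasDerivBounds (1 + 8 * (1 * c)) B (fun w => 1 - g w) := by
  simpa [sub_eq_add_neg] using (const 1 hB).add ((const (-1) hB).mul hB h)

theorem exists_hasDerivBounds_blend (c : ℝ) (y : ℕ → ℝ) (L : ℕ) :
    ∃ c', ∀ (B : ℝ) (φ : ℕ → E → ℝ), 0 ≤ B → (∀ l, HasDerivBounds c B (φ l)) →
      HasDerivBounds c' B (fun w => blend (fun l => φ l w) y L) := by
  induction L with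
  | zero => exact ⟨|0|, fun B φ hB h => HasDerivBounds.const 0 hB⟩
  | succ L ih =>
    obtain ⟨c', hc'⟩ := ih
    exact ⟨_, fun B φ hB h => ((h L).mul hB (HasDerivBounds.const (y L) hB)).add
      (((h L).one_sub hB).mul hB (hc' B φ hB h))⟩

theorem exists_hasDerivBounds_prod_one_sub (c : ℝ) (L : ℕ) :
    ∃ c', ∀ (B : ℝ) (φ : ℕ → E → ℝ), 0 ≤ B → (∀ l, HasDerivBounds c B (φ l)) →
      HasDerivBounds c' B (fun w => ∏ l ∈ Finset.range L, (1 - φ l w)) := by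
  induction L with
  | zero => exact ⟨|1|, fun B φ hB h => by simpa using HasDerivBounds.const 1 hB⟩
  | succ L ih =>
    obtain ⟨c', hc'⟩ := ih
    refine ⟨8 * (c' * (1 + 8 * (1 * c))), fun B φ hB h => ?_⟩
    simp only [Finset.prod_range_succ]
    exact (hc' B φ hB h).mul hB ((h L).one_sub hB)

theorem measurable_blend {X : Type*} [MeasurableSpace X] {φ : ℕ → X → ℝ}
    (h : ∀ l, Measurable (φ l)) (y : ℕ → ℝ) :
    ∀ L, Measurable fun w => blend (fun l => φ l w) y L
  | 0 => measurable_const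
  | L + 1 => ((h L).mul_const _).add (((h L).const_sub 1).mul (measurable_blend h y L))

end Blend

/-! ### Approximation by the class `M⁰` -/

namespace CadlagPath

variable {p : ℕ}

/-- A continuous function as an element of `D^p`. -/
def ofContinuousMap (x : C(I, EuclideanSpace ℝ (Fin p))) : CadlagPath p :=
  ⟨x, fun _ => x.continuous.continuousWithinAt,
    fun t => ⟨x t, x.continuous.continuousAt.continuousWithinAt⟩⟩

theorem continuous_ofContinuousMap (x : C(I, EuclideanSpace ℝ (Fin p))) :
    Continuous (ofContinuousMap x) := x.continuous

theorem exists_norm_sub_denseSeq_lt {w : CadlagPath p} (hw : Continuous w) {δ : ℝ} (hδ : 0 < δ) :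
    ∃ l, ‖w - ofContinuousMap
      (TopologicalSpace.denseSeq C(I, EuclideanSpace ℝ (Fin p)) l)‖ < δ := by
  obtain ⟨l, hl⟩ := (TopologicalSpace.denseRange_denseSeq
    C(I, EuclideanSpace ℝ (Fin p))).exists_dist_lt ⟨w, hw⟩ hδ
  refine ⟨l, lt_of_le_of_lt (norm_le fun t => ?_) hl⟩
  rw [sub_apply, ← dist_eq_norm]
  exact ContinuousMap.dist_apply_le_dist (f := ⟨w, hw⟩) t

theorem eventually_modulus_le {x : CadlagPath p} (hx : Continuous x) {δ : ℝ} (hδ : 0 < δ) :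
    ∀ᶠ N : ℕ in atTop, ∀ s t, dist s t ≤ 1 / (N : ℝ) → ‖x s - x t‖ ≤ δ := by
  obtain ⟨ρ, hρ, h⟩ := Metric.uniformContinuous_iff.1
    (CompactSpace.uniformContinuous_of_continuous hx) δ hδ
  filter_upwards [tendsto_one_div_atTop_nhds_zero_nat.eventually (gt_mem_nhds hρ)] with N hN s t hst
  rw [← dist_eq_norm]
  exact (h (hst.trans_lt hN)).le

end CadlagPath

/-- A grid that is fine enough for a path that is constant on intervals of length `r`, together with
a parameter `β = b ^ 3` for which the smooth maximum over the grid is accurate up to `δ`, needs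
`β ^ 2` of order `log² (1 / r)` only: `β` is proportional to the logarithm of the number of grid
points. -/
theorem exists_gridSize_bound (p K : ℕ) {δ : ℝ} (hδ : 0 < δ) :
    ∃ D, 0 ≤ D ∧ ∀ r : ℝ, 0 < r → r ≤ 1 →
    ∃ (N : ℕ) (b : ℝ), K ≤ N ∧ 0 < N ∧ 1 / (N : ℝ) ≤ r ∧ 1 ≤ b ∧
      Real.log (Fintype.card (GridIndex N p)) / b ^ 3 ≤ δ ∧
      b ^ 6 ≤ D * (1 + Real.log (1 / r) ^ 2) := by
  set A : ℝ := (K + 3) * (2 * p + 1) with hA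
  have hA1 : 1 ≤ A := by
    rw [hA]
    nlinarith [(Nat.cast_nonneg K : (0 : ℝ) ≤ K), (Nat.cast_nonneg p : (0 : ℝ) ≤ p),
      mul_nonneg (Nat.cast_nonneg K : (0 : ℝ) ≤ K) (Nat.cast_nonneg p : (0 : ℝ) ≤ p)]
  have hlogA := Real.log_nonneg hA1
  refine ⟨2 * (Real.log A / δ + 1) ^ 2 + 2 * (1 / δ) ^ 2, by positivity, fun r hr hr1 => ?_⟩
  have hr' : 1 ≤ 1 / r := (one_le_div hr).2 hr1
  have hlogr := Real.log_nonneg hr'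
  set N := ⌈1 / r⌉₊ + K with hN
  have hceil : 0 < ⌈1 / r⌉₊ := Nat.ceil_pos.2 (by positivity)
  have hN0 : 0 < N := by omega
  have hNr : 1 / r ≤ N := (Nat.le_ceil _).trans (by exact_mod_cast Nat.le_add_right _ _)
  have hcard0 : (1 : ℝ) ≤ Fintype.card (GridIndex N p) := by exact_mod_cast Fintype.card_pos
  have hcard : (Fintype.card (GridIndex N p) : ℝ) ≤ A * (1 / r) := by
    rw [card_gridIndex]
    push_cast
    have h1 : (N : ℝ) ≤ 1 / r + 1 + K := by
      rw [hN]; push_cast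
      linarith [Nat.ceil_lt_add_one (a := 1 / r) (by positivity)]
    have h2 : (N : ℝ) + 1 ≤ (K + 3) * (1 / r) := by
      nlinarith [(Nat.cast_nonneg K : (0 : ℝ) ≤ K)]
    calc ((N : ℝ) + 1) * p * 2 + 1 ≤ ((N : ℝ) + 1) * (2 * p + 1) := by
          nlinarith [(Nat.cast_nonneg N : (0 : ℝ) ≤ N)]
      _ ≤ ((K + 3) * (1 / r)) * (2 * p + 1) := by gcongr
      _ = _ := by rw [hA]; ring
  have hlogc : Real.log (Fintype.card (GridIndex N p)) ≤ Real.log A + Real.log (1 / r) := by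
    rw [← Real.log_mul (by linarith) (by linarith)]
    exact Real.log_le_log (by linarith) hcard
  have hlogc0 := Real.log_nonneg hcard0
  set β := Real.log (Fintype.card (GridIndex N p)) / δ + 1 with hβ
  have hβ1 : 1 ≤ β := by rw [hβ]; linarith [div_nonneg hlogc0 hδ.le]
  have hb3 : (β ^ ((3 : ℕ) : ℝ)⁻¹) ^ 3 = β := Real.rpow_inv_natCast_pow (by linarith) (by norm_num)
  refine ⟨N, β ^ ((3 : ℕ) : ℝ)⁻¹, by omega, hN0, ?_, Real.one_le_rpow hβ1 (by positivity), ?_, ?_⟩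
  · rw [div_le_iff₀ (by exact_mod_cast hN0)]
    rwa [div_le_iff₀ hr, mul_comm] at hNr
  · rw [hb3, div_le_iff₀ (by linarith), hβ, mul_add, mul_div_cancel₀ _ hδ.ne']
    linarith
  · rw [show (6 : ℕ) = 3 * 2 from rfl, pow_mul, hb3]
    have h1 : β ≤ (Real.log A / δ + 1) + 1 / δ * Real.log (1 / r) := by
      rw [hβ]
      have : Real.log (Fintype.card (GridIndex N p)) / δ ≤ (Real.log A + Real.log (1 / r)) / δ := by
        gcongr
      rw [add_div] at this
      linarith [this, one_div_mul_eq_div δ (Real.log (1 / r))]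
    set u := Real.log A / δ + 1
    set v := 1 / δ
    set l := Real.log (1 / r)
    calc β ^ 2 ≤ (u + v * l) ^ 2 := pow_le_pow_left₀ (by linarith) h1 2
      _ ≤ 2 * u ^ 2 + 2 * v ^ 2 * l ^ 2 := by nlinarith [sq_nonneg (u - v * l)]
      _ ≤ _ := by nlinarith [mul_nonneg (sq_nonneg u) (sq_nonneg l), sq_nonneg v]

/-- A bounded Lipschitz function for the Skorokhod metric is approximated by a functional `G`
of the class `M⁰`, both on the piecewise constant paths and near the continuous functions `x l`,
`l < L`. The error is controlled by `Q`, again of class `M⁰`, and both norms are of order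
`log² (1 / r)`. -/
theorem exists_approx_blend {p : ℕ} {f : SkorokhodSpace p → ℝ} {Λ : NNReal}
    (hf : LipschitzWith Λ f) {M : ℝ} (hM : ∀ w, |f w| ≤ M) {x : ℕ → CadlagPath p}
    (hx : ∀ l, Continuous (x l)) {δ : ℝ} (hδ : 0 < δ) (L : ℕ) :
    ∃ D, 0 ≤ D ∧ ∀ r : ℝ, 0 < r → r ≤ 1 → ∃ G Q : CadlagPath p → ℝ,
      (MemM0 G ∧ (normM0 G).toReal ≤ D * (1 + Real.log (1 / r) ^ 2)) ∧
      (MemM0 Q ∧ (normM0 Q).toReal ≤ D * (1 + Real.log (1 / r) ^ 2)) ∧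
      Measurable (fun w : SkorokhodSpace p => G w.toCadlag) ∧
      Measurable (fun w : SkorokhodSpace p => Q w.toCadlag) ∧
      (∀ w, |G w| ≤ M) ∧ (∀ w, Q w ∈ Icc (0 : ℝ) 1) ∧
      (∀ w : SkorokhodSpace p, IsPiecewiseConstant w.toCadlag r →
        |f w - G w.toCadlag| ≤ Λ * ((3 * p + 4) * δ) + M * Q w.toCadlag) ∧
      (∀ w : SkorokhodSpace p, (∃ l < L, ‖w.toCadlag - x l‖ < δ) →
        |f w - G w.toCadlag| ≤ Λ * ((3 * p + 4) * δ) ∧ Q w.toCadlag = 0) := by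
  have hM0 : 0 ≤ M := (abs_nonneg _).trans (hM (SkorokhodSpace.ofCadlag 0))
  obtain ⟨K, hK⟩ := eventually_atTop.1 ((Finset.range L).eventually_all.2
    fun l _ => CadlagPath.eventually_modulus_le (hx l) hδ)
  let ψ : ContDiffBump (0 : ℝ) := ⟨2 * δ, 3 * δ, by positivity, by linarith⟩
  obtain ⟨A, hA⟩ := exists_bound_iteratedFDeriv (ψ := ψ) ψ.contDiff ψ.hasCompactSupport
  set y : ℕ → ℝ := fun l => f (SkorokhodSpace.ofCadlag (x l)) with hy
  obtain ⟨c₁, hc₁⟩ := exists_hasDerivBounds_blend (E := CadlagPath p) (6 * A) y L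
  obtain ⟨c₂, hc₂⟩ := exists_hasDerivBounds_prod_one_sub (E := CadlagPath p) (6 * A) L
  obtain ⟨D, hD0, hD⟩ := exists_gridSize_bound p K hδ
  have hκ := one_le_logSumExpConst
  set κ := logSumExpConst
  refine ⟨4 * ((|c₁| + |c₂|) * κ ^ 3) * D, by positivity, fun r hr hr1 => ?_⟩
  obtain ⟨N, b, hKN, hN, hNr, hb, hlog, hb6⟩ := hD r hr hr1
  have hβ : 0 < b ^ 3 := by positivity
  -- `φ l` is `1` on the ball of radius `δ` about `x l`; on regular paths it vanishes at distances
  -- above `(3 * p + 4) * δ`.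
  set φ : ℕ → CadlagPath p → ℝ := fun l w => ψ (smoothDist N (b ^ 3) (x l) w) with hφ
  have hφd : ∀ l, HasDerivBounds (6 * A) (κ * b ^ 2) (φ l) := fun l =>
    hasDerivBounds_comp_smoothDist ψ.contDiff hA hb (x l)
  have hφm : ∀ l, Measurable fun w : SkorokhodSpace p => φ l w.toCadlag := fun l =>
    ψ.continuous.measurable.comp (measurable_smoothDist (x l))
  have hφ0 : ∀ l w, 0 ≤ φ l w := fun l w => ψ.nonneg
  have hφ1 : ∀ l w, φ l w ≤ 1 := fun l w => ψ.le_one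
  have hB : 1 ≤ κ * b ^ 2 := one_le_mul_of_one_le_of_one_le hκ (one_le_pow₀ hb)
  have hmem : ∀ {c : ℝ} {g : CadlagPath p → ℝ}, |c| ≤ |c₁| + |c₂| →
      HasDerivBounds c (κ * b ^ 2) g → MemM0 g ∧
        (normM0 g).toReal ≤ 4 * ((|c₁| + |c₂|) * κ ^ 3) * D * (1 + Real.log (1 / r) ^ 2) := by
    intro c g hc hg
    obtain ⟨h1, h2⟩ := hg.memM0 hB
    have hc0 := hg.nonneg
    refine ⟨h1, (ENNReal.toReal_le_of_le_ofReal (by positivity) h2).trans ?_⟩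
    calc 4 * (c * (κ * b ^ 2) ^ 3) = 4 * (c * κ ^ 3) * b ^ 6 := by ring
      _ ≤ 4 * ((|c₁| + |c₂|) * κ ^ 3) * (D * (1 + Real.log (1 / r) ^ 2)) := by
          gcongr
          exact (le_abs_self c).trans hc
      _ = _ := by ring
  have hφ_one : ∀ l w, ‖w - x l‖ ≤ δ → φ l w = 1 := fun l w hw => by
    refine ψ.one_of_mem_closedBall ?_
    rw [mem_closedBall_zero_iff, Real.norm_of_nonneg (smoothDist_nonneg hβ _ _)]
    exact (smoothDist_le hβ (x l) w).trans (show _ ≤ 2 * δ by linarith)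
  have hclose : ∀ w : SkorokhodSpace p, GridRegular N (3 * δ) w.toCadlag → ∀ l < L,
      φ l w.toCadlag ≠ 0 → |f w - y l| ≤ Λ * ((3 * p + 4) * δ) := by
    intro w hw l hl hne
    have h1 : smoothDist N (b ^ 3) (x l) w.toCadlag ≤ 3 * δ := by
      by_contra! hcon
      refine hne (ψ.zero_of_le_dist ?_)
      rw [dist_zero_right, Real.norm_of_nonneg (smoothDist_nonneg hβ _ _)]
      exact hcon.le
    have h2 := norm_sub_le_of_smoothDist_le hβ (hK N hKN l (Finset.mem_range.2 hl)) hw h1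
    have h3 := hf.dist_le_mul w (SkorokhodSpace.ofCadlag (x l))
    rw [Real.dist_eq] at h3
    refine h3.trans (mul_le_mul_of_nonneg_left ?_ Λ.2)
    exact (SkorokhodSpace.dist_le_norm_sub _ _).trans h2
  have hest : ∀ w : SkorokhodSpace p, GridRegular N (3 * δ) w.toCadlag →
      |f w - blend (fun l => φ l w.toCadlag) y L| ≤ Λ * ((3 * p + 4) * δ)
        + M * ∏ l ∈ Finset.range L, (1 - φ l w.toCadlag) := fun w hw =>
    abs_sub_blend_le (fun l => hφ0 l _) (fun l => hφ1 l _) (hM w) (by positivity) L (hclose w hw)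
  refine ⟨fun w => blend (fun l => φ l w) y L, fun w => ∏ l ∈ Finset.range L, (1 - φ l w),
    hmem (by linarith [abs_nonneg c₂]) (hc₁ _ φ (by linarith) hφd),
    hmem (by linarith [abs_nonneg c₁]) (hc₂ _ φ (by linarith) hφd),
    measurable_blend hφm y L, Finset.measurable_prod _ fun l _ => (hφm l).const_sub 1,
    fun w => abs_blend_le (fun l => hφ0 l w) (fun l => hφ1 l w) hM0 (fun l => hM _) L,
    fun w => prod_one_sub_mem_Icc (fun l => hφ0 l w) (fun l => hφ1 l w) L,
    fun w hw => hest w (hw.gridRegular hN hNr (by positivity)), ?_⟩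
  rintro w ⟨l, hl, hwl⟩
  have hQ : ∏ l ∈ Finset.range L, (1 - φ l w.toCadlag) = 0 :=
    Finset.prod_eq_zero (Finset.mem_range.2 hl) (by rw [hφ_one l _ hwl.le, sub_self])
  have h := hest w (gridRegular_of_norm_sub_le hN (hK N hKN l (Finset.mem_range.2 hl)) hwl.le)
  rw [hQ, mul_zero, add_zero] at h
  exact ⟨h, hQ⟩

/-! ### Convergence for the Skorokhod topology -/

/-- If `G` approximates `f` up to `η` outside a set `F` that is small for `ν`, and up to
`η + M * Q` almost everywhere for `μ`, then `f` has nearly the same integral for `μ` and `ν` as soon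
as this is so for `G` and `Q`. The function `Q` vanishes outside `F`, so that its integral for `ν`,
hence that for `μ`, is small. -/
theorem abs_integral_sub_integral_le {X : Type*} [MeasurableSpace X] {μ ν : Measure X}
    [IsProbabilityMeasure μ] [IsProbabilityMeasure ν] {f G Q : X → ℝ} {F : Set X} {M η e e' : ℝ}
    (hF : MeasurableSet F) (hf : Measurable f) (hG : Measurable G) (hQ : Measurable Q)
    (hM : 0 ≤ M) (hη : 0 ≤ η) (hfM : ∀ x, |f x| ≤ M) (hGM : ∀ x, |G x| ≤ M)
    (hQ1 : ∀ x, Q x ∈ Icc (0 : ℝ) 1)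
    (hμ : ∀ᵐ x ∂μ, |f x - G x| ≤ η + M * Q x) (hν : ∀ x ∉ F, |f x - G x| ≤ η)
    (hQF : ∀ x ∉ F, Q x = 0) (hGe : |∫ x, G x ∂μ - ∫ x, G x ∂ν| ≤ e)
    (hQe : |∫ x, Q x ∂μ - ∫ x, Q x ∂ν| ≤ e') :
    |∫ x, f x ∂μ - ∫ x, f x ∂ν| ≤ 2 * η + e + M * e' + 3 * M * ν.real F := by
  have hint : ∀ (ρ : Measure X) [IsProbabilityMeasure ρ] {g : X → ℝ} {B : ℝ}, Measurable g →
      (∀ x, |g x| ≤ B) → Integrable g ρ := fun ρ _ g B hg hB =>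
    Integrable.of_bound hg.aestronglyMeasurable B (ae_of_all _ hB)
  have hQabs : ∀ x, |Q x| ≤ 1 := fun x => by rw [abs_of_nonneg (hQ1 x).1]; exact (hQ1 x).2
  have hind : Integrable (F.indicator fun _ => (1 : ℝ)) ν :=
    (integrable_const (1 : ℝ)).indicator hF
  have hindint : ∫ x, F.indicator (fun _ => (1 : ℝ)) x ∂ν = ν.real F := integral_indicator_one hF
  have h1 : |∫ x, f x ∂μ - ∫ x, G x ∂μ| ≤ η + M * ∫ x, Q x ∂μ := by
    have hb := norm_integral_le_of_norm_le (f := fun x => f x - G x) (g := fun x => η + M * Q x)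
      ((integrable_const η).add ((hint μ hQ hQabs).const_mul M)) hμ
    rw [integral_sub (hint μ hf hfM) (hint μ hG hGM), integral_add (integrable_const η)
      ((hint μ hQ hQabs).const_mul M), integral_const_mul] at hb
    simpa using hb
  have h2 : |∫ x, f x ∂ν - ∫ x, G x ∂ν| ≤ η + 2 * M * ν.real F := by
    have hb := norm_integral_le_of_norm_le (μ := ν) (f := fun x => f x - G x)
      (g := fun x => η + 2 * M * F.indicator (fun _ => (1 : ℝ)) x)
      ((integrable_const η).add (hind.const_mul (2 * M))) (ae_of_all _ fun x => by
        by_cases hx : x ∈ F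
        · have h3 := (abs_sub (f x) (G x)).trans (add_le_add (hfM x) (hGM x))
          simp only [hx, indicator_of_mem, mul_one, Real.norm_eq_abs]
          linarith
        · simpa [hx] using hν x hx)
    rw [integral_sub (hint ν hf hfM) (hint ν hG hGM), integral_add (integrable_const η)
      (hind.const_mul (2 * M)), integral_const_mul, hindint] at hb
    simpa using hb
  have h3 : ∫ x, Q x ∂ν ≤ ν.real F := by
    rw [← hindint]
    refine integral_mono (hint ν hQ hQabs) hind fun x => ?_
    by_cases hx : x ∈ F
    · simpa [hx] using (hQ1 x).2
    · simp [hx, hQF x hx]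
  have h4 : M * ∫ x, Q x ∂μ ≤ M * (e' + ν.real F) :=
    mul_le_mul_of_nonneg_left (by linarith [(abs_le.1 hQe).2]) hM
  rw [abs_le] at *
  constructor <;> linarith [h1.1, h1.2, h2.1, h2.2, hGe.1, hGe.2]

/-- If the limit law is carried by the continuous functions, then eventually the laws `ν n` give
little mass to the complement of finitely many `δ`-balls of the supremum norm, since the union of
such balls with continuous centres is open for the Skorokhod topology. -/
theorem exists_eventually_measure_lt {p : ℕ} {ν : ℕ → ProbabilityMeasure (SkorokhodSpace p)}
    {ν' : ProbabilityMeasure (SkorokhodSpace p)} (hν : Tendsto ν atTop (𝓝 ν'))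
    (hc : ∀ᵐ w ∂(ν' : Measure (SkorokhodSpace p)), Continuous w.toCadlag)
    {x : ℕ → CadlagPath p} (hx : ∀ l, Continuous (x l)) {δ : ℝ}
    (hxd : ∀ w : CadlagPath p, Continuous w → ∃ l, ‖w - x l‖ < δ) {ε : ℝ} (hε : 0 < ε) :
    ∃ L : ℕ, IsClosed {w : SkorokhodSpace p | ∀ l < L, δ ≤ ‖w.toCadlag - x l‖} ∧
      ∀ᶠ n in atTop, (ν n : Measure (SkorokhodSpace p)).real
        {w : SkorokhodSpace p | ∀ l < L, δ ≤ ‖w.toCadlag - x l‖} < ε := by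
  set F : ℕ → Set (SkorokhodSpace p) := fun L => {w | ∀ l < L, δ ≤ ‖w.toCadlag - x l‖} with hF
  have hclosed : ∀ L, IsClosed (F L) := fun L => by
    have : F L = ⋂ l, ⋂ (_ : l < L), {w : SkorokhodSpace p | ‖w.toCadlag - x l‖ < δ}ᶜ := by
      ext w; simp [hF]
    rw [this]
    exact isClosed_iInter fun l => isClosed_iInter fun _ =>
      (SkorokhodSpace.isOpen_norm_sub_lt (hx l) δ).isClosed_compl
  have hanti : Antitone F := fun L L' h w hw l hl => hw l (hl.trans_le h)
  have hlim := tendsto_measure_iInter_atTop (μ := (ν' : Measure (SkorokhodSpace p)))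
    (fun L => (hclosed L).measurableSet.nullMeasurableSet) hanti ⟨0, measure_ne_top _ _⟩
  have hzero : (ν' : Measure (SkorokhodSpace p)) (⋂ L, F L) = 0 := by
    refine measure_mono_null (t := {w | ¬ Continuous w.toCadlag}) ?_ (ae_iff.1 hc)
    intro w hw hcont
    obtain ⟨l, hl⟩ := hxd _ hcont
    exact absurd hl (not_lt.2 (mem_iInter.1 hw (l + 1) l (Nat.lt_succ_self l)))
  rw [hzero] at hlim
  obtain ⟨L, hL⟩ := (hlim.eventually (gt_mem_nhds (ENNReal.ofReal_pos.2 hε))).exists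
  refine ⟨L, hclosed L, ?_⟩
  have h1 := (ProbabilityMeasure.limsup_measure_closed_le_of_tendsto hν (hclosed L)).trans_lt hL
  filter_upwards [eventually_lt_of_limsup_lt h1] with n hn
  exact (ENNReal.lt_ofReal_iff_toReal_lt (measure_ne_top _ _)).1 hn

theorem tendsto_integral_sub_of_lipschitz {p : ℕ} {μ ν : ℕ → ProbabilityMeasure (SkorokhodSpace p)}
    {ν' : ProbabilityMeasure (SkorokhodSpace p)} (hν : Tendsto ν atTop (𝓝 ν'))
    (hc : ∀ᵐ w ∂(ν' : Measure (SkorokhodSpace p)), Continuous w.toCadlag)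
    {r : ℕ → ℝ} (hr : ∀ n, 0 < r n) (hr1 : ∀ n, r n ≤ 1)
    (hμ : ∀ n (S : Set (SkorokhodSpace p)), MeasurableSet S →
      (∀ w, IsPiecewiseConstant w.toCadlag (r n) → w ∈ S) →
      ∀ᵐ w ∂(μ n : Measure (SkorokhodSpace p)), w ∈ S)
    {C : ℝ} {τ : ℕ → ℝ} (hτ : Tendsto τ atTop (𝓝 0))
    (hτr : Tendsto (fun n => τ n * Real.log (1 / r n) ^ 2) atTop (𝓝 0))
    (hg : ∀ (n : ℕ) (g : CadlagPath p → ℝ), MemM0 g →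
      Measurable (fun w : SkorokhodSpace p => g w.toCadlag) →
      |∫ w, g w.toCadlag ∂(μ n : Measure (SkorokhodSpace p))
          - ∫ w, g w.toCadlag ∂(ν n : Measure (SkorokhodSpace p))|
        ≤ C * τ n * (normM0 g).toReal)
    {f : SkorokhodSpace p → ℝ} {Λ : NNReal} (hf : LipschitzWith Λ f) {M : ℝ}
    (hM : ∀ w, |f w| ≤ M) :
    Tendsto (fun n => ∫ w, f w ∂(μ n : Measure (SkorokhodSpace p))
      - ∫ w, f w ∂(ν n : Measure (SkorokhodSpace p))) atTop (𝓝 0) := by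
  have hM0 : 0 ≤ M := (abs_nonneg _).trans (hM (SkorokhodSpace.ofCadlag 0))
  rw [Metric.tendsto_nhds]
  intro ε hε
  -- The error is at most `ε / 4` from the Lipschitz approximation, `ε / 4` from the mass outside
  -- the balls, and `ε / 4` from the hypothesis on the class `M⁰`.
  set δ := ε / (8 * (Λ * (3 * p + 4) + 1)) with hδ
  have hδ0 : 0 < δ := by positivity
  have hδε : 2 * (Λ * ((3 * p + 4) * δ)) ≤ ε / 4 := by
    have : 8 * (Λ * (3 * p + 4) + 1) * δ = ε := mul_div_cancel₀ _ (by positivity)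
    linarith
  set x : ℕ → CadlagPath p := fun l => CadlagPath.ofContinuousMap
    (TopologicalSpace.denseSeq C(I, EuclideanSpace ℝ (Fin p)) l)
  have hx : ∀ l, Continuous (x l) := fun l => CadlagPath.continuous_ofContinuousMap _
  obtain ⟨L, hFc, hF⟩ := exists_eventually_measure_lt hν hc hx
    (fun w hw => CadlagPath.exists_norm_sub_denseSeq_lt hw hδ0)
    (show 0 < ε / (12 * (M + 1)) by positivity)
  obtain ⟨D, hD0, hD⟩ := exists_approx_blend hf hM hx hδ0 L
  set e : ℕ → ℝ := fun n => |C| * D * |τ n + τ n * Real.log (1 / r n) ^ 2| with he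
  have he0 : Tendsto (fun n => (1 + M) * e n) atTop (𝓝 0) := by
    have h := ((hτ.add hτr).abs.const_mul (|C| * D)).const_mul (1 + M)
    rwa [add_zero, abs_zero, mul_zero, mul_zero] at h
  filter_upwards [hF, he0.eventually (gt_mem_nhds (show 0 < ε / 4 by positivity))] with n hn hen
  obtain ⟨G, Q, ⟨hG, hGn⟩, ⟨hQ, hQn⟩, hGm, hQm, hGM, hQ1, hpc, hball⟩ := hD (r n) (hr n) (hr1 n)
  have hle : ∀ {g : CadlagPath p → ℝ}, (normM0 g).toReal ≤ D * (1 + Real.log (1 / r n) ^ 2) →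
      C * τ n * (normM0 g).toReal ≤ e n := fun {g} hgn => by
    calc C * τ n * (normM0 g).toReal ≤ |C * τ n| * (D * (1 + Real.log (1 / r n) ^ 2)) :=
          mul_le_mul (le_abs_self _) hgn ENNReal.toReal_nonneg (abs_nonneg _)
      _ = |C| * D * (|τ n| * (1 + Real.log (1 / r n) ^ 2)) := by rw [abs_mul]; ring
      _ = e n := by
          rw [← abs_of_nonneg (show 0 ≤ 1 + Real.log (1 / r n) ^ 2 by positivity), ← abs_mul,
            mul_add, mul_one]
  have hfm : Measurable f := hf.continuous.measurable
  have key := abs_integral_sub_integral_le (μ := (μ n : Measure (SkorokhodSpace p)))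
    (ν := (ν n : Measure (SkorokhodSpace p))) hFc.measurableSet hfm hGm hQm hM0
    (η := Λ * ((3 * p + 4) * δ)) (by positivity) hM (fun w => hGM _) (fun w => hQ1 _)
    (hμ n {w | |f w - G w.toCadlag| ≤ Λ * ((3 * p + 4) * δ) + M * Q w.toCadlag}
      (measurableSet_le (hfm.sub hGm).abs ((hQm.const_mul M).const_add _)) hpc)
    (fun w hw => (hball w (by simpa using hw)).1) (fun w hw => (hball w (by simpa using hw)).2)
    ((hg n G hG hGm).trans (hle hGn)) ((hg n Q hQ hQm).trans (hle hQn))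
  rw [dist_zero_right, Real.norm_eq_abs]
  refine key.trans_lt ?_
  have h1 : 3 * M * (ν n : Measure (SkorokhodSpace p)).real
      {w : SkorokhodSpace p | ∀ l < L, δ ≤ ‖w.toCadlag - x l‖} ≤ ε / 4 := by
    calc _ ≤ 3 * M * (ε / (12 * (M + 1))) := by gcongr
      _ ≤ 3 * (M + 1) * (ε / (12 * (M + 1))) := by gcongr; linarith
      _ = ε / 4 := by field_simp; norm_num
  linarith

/-! ### From the Skorokhod to the uniform topology -/

section OuterExpectation

variable {Ω : Type*} [MeasurableSpace Ω] {P : Measure Ω}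

theorem outerExpectation_le {φ ψ : Ω → ℝ} {B : ℝ} [IsProbabilityMeasure P] (hB : ∀ ω, B ≤ φ ω)
    (hψ : Integrable ψ P) (h : ∀ ω, φ ω ≤ ψ ω) : outerExpectation P φ ≤ ∫ ω, ψ ω ∂P := by
  refine csInf_le ⟨B, ?_⟩ ⟨ψ, hψ, h, rfl⟩
  rintro _ ⟨ψ', hψ', h', rfl⟩
  simpa using integral_mono (integrable_const B) hψ' fun ω => (hB ω).trans (h' ω)

theorem le_outerExpectation {φ ψ : Ω → ℝ} {B : ℝ} [IsProbabilityMeasure P] (hB : ∀ ω, φ ω ≤ B)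
    (hψ : Integrable ψ P) (h : ∀ ω, ψ ω ≤ φ ω) : ∫ ω, ψ ω ∂P ≤ outerExpectation P φ := by
  refine le_csInf ⟨_, fun _ => B, integrable_const B, hB, rfl⟩ ?_
  rintro _ ⟨ψ', hψ', h', rfl⟩
  exact integral_mono hψ hψ' fun ω => (h ω).trans (h' ω)

end OuterExpectation

section Envelope

variable {X : Type*} [PseudoMetricSpace X] {f : X → ℝ} {M : ℝ}

/-- The sup-convolution `w ↦ sup_v (f v - k d(w, v))`, the least `k`-Lipschitz function
above `f`. -/
def lipschitzEnvelope (f : X → ℝ) (k : ℕ) (w : X) : ℝ := ⨆ v, (f v - k * dist w v)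

theorem bddAbove_lipschitzEnvelope (hM : ∀ w, |f w| ≤ M) (k : ℕ) (w : X) :
    BddAbove (range fun v => f v - k * dist w v) := by
  refine ⟨M, ?_⟩
  rintro _ ⟨v, rfl⟩
  have h1 := (abs_le.1 (hM v)).2
  have h2 : 0 ≤ (k : ℝ) * dist w v := by positivity
  exact (by linarith : f v - k * dist w v ≤ M)

theorem le_lipschitzEnvelope (hM : ∀ w, |f w| ≤ M) (k : ℕ) (w : X) :
    f w ≤ lipschitzEnvelope f k w := by
  refine (le_of_eq ?_).trans (le_ciSup (bddAbove_lipschitzEnvelope hM k w) w)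
  simp

theorem abs_lipschitzEnvelope_le (hM : ∀ w, |f w| ≤ M) (k : ℕ) (w : X) :
    |lipschitzEnvelope f k w| ≤ M := by
  have : Nonempty X := ⟨w⟩
  refine abs_le.2 ⟨(abs_le.1 (hM w)).1.trans (le_lipschitzEnvelope hM k w), ciSup_le fun v => ?_⟩
  have h1 := (abs_le.1 (hM v)).2
  have h2 : 0 ≤ (k : ℝ) * dist w v := by positivity
  linarith

theorem lipschitzWith_lipschitzEnvelope (hM : ∀ w, |f w| ≤ M) (k : ℕ) :
    LipschitzWith k (lipschitzEnvelope f k) := by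
  refine LipschitzWith.of_le_add_mul _ fun w v => ?_
  have : Nonempty X := ⟨w⟩
  refine ciSup_le fun u => ?_
  have h1 := le_ciSup (bddAbove_lipschitzEnvelope hM k v) u
  have h2 := mul_le_mul_of_nonneg_left (dist_triangle v w u) (Nat.cast_nonneg k : (0 : ℝ) ≤ k)
  rw [dist_comm v w, mul_add] at h2
  change f u - k * dist v u ≤ lipschitzEnvelope f k v at h1
  simp only [NNReal.coe_natCast]
  linarith

theorem tendsto_lipschitzEnvelope (hM : ∀ w, |f w| ≤ M) {x : X} (hx : ContinuousAt f x) :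
    Tendsto (fun k => lipschitzEnvelope f k x) atTop (𝓝 (f x)) := by
  have : Nonempty X := ⟨x⟩
  refine tendsto_order.2 ⟨fun a ha => Eventually.of_forall fun k =>
    ha.trans_le (le_lipschitzEnvelope hM k x), fun a ha => ?_⟩
  obtain ⟨c, hc, hca⟩ := exists_between ha
  obtain ⟨ρ, hρ, h⟩ := Metric.eventually_nhds_iff.1 (hx.eventually (gt_mem_nhds hc))
  obtain ⟨k₀, hk₀⟩ := exists_nat_ge (2 * M / ρ)
  filter_upwards [eventually_ge_atTop k₀] with k hk
  refine lt_of_le_of_lt (ciSup_le fun v => ?_) hca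
  have hd : 0 ≤ (k : ℝ) * dist x v := by positivity
  rcases lt_or_ge (dist v x) ρ with hv | hv
  · linarith [h hv]
  · have h1 : 2 * M ≤ k * dist x v := by
      rw [div_le_iff₀ hρ] at hk₀
      rw [dist_comm]
      have : (k₀ : ℝ) ≤ k := by exact_mod_cast hk
      calc 2 * M ≤ k₀ * ρ := hk₀
        _ ≤ k * dist v x := by gcongr
    linarith [(abs_le.1 (hM v)).2, (abs_le.1 (hM x)).1]

end Envelope

/-- If the limit is almost surely continuous, then convergence in distribution for the Skorokhod
topology implies weak convergence for the supremum norm. A function that is continuous for the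
supremum norm is continuous for the Skorokhod topology at every continuous path, so it is
sandwiched between Skorokhod-Lipschitz functions whose integrals at the limit are arbitrarily
close. -/
theorem weaklyTendsto_toCadlag {p : ℕ} {ΩY : ℕ → Type*} [∀ n, MeasurableSpace (ΩY n)]
    {Ω : Type*} [MeasurableSpace Ω] {PY : ∀ n, Measure (ΩY n)} [∀ n, IsProbabilityMeasure (PY n)]
    {P : Measure Ω} [IsProbabilityMeasure P] {Y : ∀ n, ΩY n → SkorokhodSpace p}
    {Z : Ω → SkorokhodSpace p} (hY : TendstoInDistribution Y atTop Z PY P)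
    (hZ : ∀ᵐ ω ∂P, Continuous (Z ω).toCadlag) :
    WeaklyTendsto (fun n ω => (Y n ω).toCadlag) (fun ω => (Z ω).toCadlag) PY P := by
  have hYm := hY.forall_aemeasurable
  have hZm := hY.aemeasurable_limit
  refine ⟨SkorokhodSpace.aemeasurable_toCadlag hZm hZ, fun f => ?_⟩
  have hlip : ∀ {Λ : NNReal} {M : ℝ} {h : SkorokhodSpace p → ℝ}, LipschitzWith Λ h →
      (∀ w, |h w| ≤ M) → Tendsto (fun n => ∫ ω, h (Y n ω) ∂(PY n)) atTop
        (𝓝 (∫ ω, h (Z ω) ∂P)) := by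
    intro Λ M h hh hM
    have h1 := tendsto_iff_forall_lipschitz_integral_tendsto.1 hY.tendsto h
      ⟨2 * M, fun w v => by
        rw [Real.dist_eq]
        linarith [abs_sub (h w) (h v), hM w, hM v]⟩ ⟨Λ, hh⟩
    simp only [ProbabilityMeasure.coe_mk] at h1
    rw [integral_map hZm hh.continuous.aestronglyMeasurable] at h1
    refine h1.congr fun n => ?_
    rw [integral_map (hYm n) hh.continuous.aestronglyMeasurable]
  set F : SkorokhodSpace p → ℝ := fun w => f w.toCadlag with hF
  have hM : ∀ w, |F w| ≤ ‖f‖ := fun w => f.norm_coe_le_norm _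
  have hMneg : ∀ w, |(-F) w| ≤ ‖f‖ := fun w => by simpa using hM w
  have hFc : ∀ w : SkorokhodSpace p, Continuous w.toCadlag → ContinuousAt F w := fun w hw =>
    f.continuous.continuousAt.comp (SkorokhodSpace.continuousAt_toCadlag hw)
  have henv : ∀ {h : SkorokhodSpace p → ℝ}, (∀ w, |h w| ≤ ‖f‖) →
      (∀ w : SkorokhodSpace p, Continuous w.toCadlag → ContinuousAt h w) →
      Tendsto (fun k => ∫ ω, lipschitzEnvelope h k (Z ω) ∂P) atTop (𝓝 (∫ ω, h (Z ω) ∂P)) := by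
    intro h hh hcont
    refine tendsto_integral_of_dominated_convergence (fun _ => ‖f‖) (fun k => ?_)
      (integrable_const _) (fun k => ae_of_all _ fun ω => abs_lipschitzEnvelope_le hh k _) ?_
    · exact ((lipschitzWith_lipschitzEnvelope hh k).continuous.measurable.comp_aemeasurable
        hZm).aestronglyMeasurable
    · filter_upwards [hZ] with ω hω using tendsto_lipschitzEnvelope hh (hcont _ hω)
  have hint : ∀ {h : SkorokhodSpace p → ℝ}, (∀ w, |h w| ≤ ‖f‖) → ∀ (k n : ℕ),
      Integrable (fun ω => lipschitzEnvelope h k (Y n ω)) (PY n) := fun {h} hh k n =>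
    Integrable.of_bound
      ((lipschitzWith_lipschitzEnvelope hh k).continuous.measurable.comp_aemeasurable
        (hYm n)).aestronglyMeasurable ‖f‖ (ae_of_all _ fun ω => abs_lipschitzEnvelope_le hh k _)
  refine tendsto_order.2 ⟨fun a ha => ?_, fun a ha => ?_⟩
  · -- The lower bound comes from the envelopes of `-F`.
    have h1 := (henv hMneg fun w hw => (hFc w hw).neg).neg
    simp only [Pi.neg_apply, integral_neg, neg_neg] at h1
    obtain ⟨k, hk⟩ := (h1.eventually (lt_mem_nhds ha)).exists
    have h2 := (hlip (lipschitzWith_lipschitzEnvelope hMneg k)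
      (abs_lipschitzEnvelope_le hMneg k)).neg
    filter_upwards [h2.eventually (lt_mem_nhds hk)] with n hn
    refine hn.trans_le ?_
    rw [← integral_neg]
    refine le_outerExpectation (B := ‖f‖) (fun ω => (abs_le.1 (hM (Y n ω))).2)
      (hint hMneg k n).neg fun ω => ?_
    have := le_lipschitzEnvelope hMneg k (Y n ω)
    simp only [Pi.neg_apply, hF] at this
    linarith
  · obtain ⟨k, hk⟩ := ((henv hM hFc).eventually (gt_mem_nhds ha)).exists
    filter_upwards [(hlip (lipschitzWith_lipschitzEnvelope hM k)
      (abs_lipschitzEnvelope_le hM k)).eventually (gt_mem_nhds hk)] with n hn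
    exact (outerExpectation_le (B := -‖f‖) (fun ω => (abs_le.1 (hM (Y n ω))).1)
      (hint hM k n) fun ω => le_lipschitzEnvelope hM k (Y n ω)).trans_lt hn

end

theorem proposition2p1 {p : ℕ}
    {ΩY ΩZ : ℕ → Type*} [∀ n, MeasurableSpace (ΩY n)] [∀ n, MeasurableSpace (ΩZ n)]
    {Ω : Type*} [MeasurableSpace Ω]
    (PY : ∀ n, Measure (ΩY n)) [∀ n, IsProbabilityMeasure (PY n)]
    (PZ : ∀ n, Measure (ΩZ n)) [∀ n, IsProbabilityMeasure (PZ n)]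
    (P : Measure Ω) [IsProbabilityMeasure P]
    (Y : ∀ n, ΩY n → SkorokhodSpace p) (hY : ∀ n, AEMeasurable (Y n) (PY n))
    (r : ℕ → ℝ) (hr : ∀ n, 0 < r n)
    (hYr : ∀ n, ∀ᵐ ω ∂(PY n), IsPiecewiseConstant (Y n ω).toCadlag (r n))
    (Zn : ∀ n, ΩZ n → SkorokhodSpace p) (Z : Ω → SkorokhodSpace p)
    (hZn : TendstoInDistribution Zn atTop Z PZ P)
    (hZ : ∀ᵐ ω ∂P, Continuous (Z ω).toCadlag)
    (C : ℝ) (τ : ℕ → ℝ)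
    (hτ : Tendsto τ atTop (𝓝 0))
    (hτr : Tendsto (fun n => τ n * Real.log (1 / r n) ^ 2) atTop (𝓝 0))
    (hg : ∀ (n : ℕ) (g : CadlagPath p → ℝ), MemM0 g →
      Measurable (fun w : SkorokhodSpace p => g w.toCadlag) →
      |∫ ω, g (Y n ω).toCadlag ∂(PY n) - ∫ ω, g (Zn n ω).toCadlag ∂(PZ n)|
        ≤ C * τ n * (normM0 g).toReal) :
    WeaklyTendsto (fun n ω => (Y n ω).toCadlag) (fun ω => (Z ω).toCadlag) PY P ∧
      TendstoInDistribution Y atTop Z PY P := by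
  have hZnm := hZn.forall_aemeasurable
  have hZm := hZn.aemeasurable_limit
  -- An interval of constancy has length at most `1`.
  have hr1 : ∀ n, r n ≤ 1 := fun n => by
    obtain ⟨ω, hω⟩ := (hYr n).exists
    exact hω.le_one (hr n)
  suffices h : TendstoInDistribution Y atTop Z PY P from ⟨weaklyTendsto_toCadlag h hZ, h⟩
  refine ⟨hY, hZm, tendsto_iff_forall_lipschitz_integral_tendsto.2 ?_⟩
  rintro f ⟨B, hB⟩ ⟨Λ, hΛ⟩
  have h1 := tendsto_integral_sub_of_lipschitz
    (μ := fun n => ⟨(PY n).map (Y n), Measure.isProbabilityMeasure_map (hY n)⟩) hZn.tendsto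
    ((ae_map_iff hZm SkorokhodSpace.isClosed_setOf_continuous.measurableSet).2 hZ) hr hr1
    (fun n S hS hpc => (ae_map_iff (hY n) hS).2 ((hYr n).mono fun ω hω => hpc _ hω)) hτ hτr
    (fun n g hgM hgm => by
      simp only [ProbabilityMeasure.coe_mk]
      rw [integral_map (hY n) hgm.aestronglyMeasurable,
        integral_map (hZnm n) hgm.aestronglyMeasurable]
      exact hg n g hgM hgm)
    hΛ (M := |f (SkorokhodSpace.ofCadlag 0)| + B) fun w => by
      have h2 := hB w (SkorokhodSpace.ofCadlag 0)
      rw [Real.dist_eq] at h2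
      have h3 := abs_sub_abs_le_abs_sub (f w) (f (SkorokhodSpace.ofCadlag 0))
      linarith
  have h2 := tendsto_iff_forall_lipschitz_integral_tendsto.1 hZn.tendsto f ⟨B, hB⟩ ⟨Λ, hΛ⟩
  simpa using h1.add h2
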